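/- Let $\Omega=(\mathbb R/2\pi\mathbb Z)^2$. Let $H$ be the space of real, mean-free, divergence-free (in the sense of distributions) vector fields in $L^2(\Omega)^2$, with norm $|u|^2=\int_\Omega|u|^2dx$. Let $V$ be the space of $u\in H$ with weak first derivatives in $L^2$, with norm $\|u\|^2=\sum_j\int_\Omega|\partial_ju|^2dx$. Let $\mathbb P$ be the Leray projection, $A=-\mathbb P\Delta$ the Stokes operator with domain $D(A)\subset H$, $B(u,v)=\mathbb P((u\cdot\nabla)v)$, and for real $N>0$ let $P_N$ be the projection onto the Fourier wavenumbers $k\in\mathbb Z^2$ with $|k|\le N$. Let $\nu>0$ and $g_1,g_2\in L^\infty(0,\infty;H)$, and put $\mathfrak g_j=\nu^{-2}\sup_{t\ge0}|g_j(t)|$ (essential supremum) and $\mathfrak g^2=\mathfrak g_1^2+\mathfrak g_2^2$. For $\mu_1,\mu_2\ge0$ and $M>0$, the mutual nudging intertwinement with cut-off $M$ is the system $$\frac{dv_1}{dt}+\nu Av_1+B(v_1,v_1)=g_1+\mu_1(P_Mv_2-P_Mv_1),\qquad \frac{dv_2}{dt}+\nu Av_2+B(v_2,v_2)=g_2+\mu_2(P_Mv_1-P_Mv_2),$$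 and $(v_1,v_2)$ denotes any global strong solution of it, i.e. $v_j\in C([0,T];V)\cap L^2(0,T;D(A))$ and $\frac{dv_j}{dt}\in L^2(0,T;H)$ for all $T>0$, with arbitrary initial data in $V\times V$. Theorem. There is an absolute constant $C_L>0$ such that the Ladyzhenskaya inequality $\left(\int_\Omega|u|^4dx\right)^{1/2}\le C_L\|u\|\,|u|$ holds for all $u\in V$. Moreover: (i) For all $\mu_1,\mu_2\ge 0$ the mutual nudging intertwinement is finite-dimensionally assisted self-synchronous: there is $N>0$ such that, for every cut-off $M>0$ (for instance $M=N$), if $|g_1(t)-g_2(t)|\to0$ and $|P_Nv_1(t)-P_Nv_2(t)|\to0$ as $t\to\infty$, then $|v_1(t)-v_2(t)|\to0$ as $t\to\infty$, for all solutions $(v_1,v_2)$. (ii) If $\mu_1,\mu_2>0$ and $C_L>0$ is any constant for which the Ladyzhenskaya inequality above holds, then the implication in (i) holds, for every $M>0$ (in particular for $M=N$), for every $N>0$ with $$N\ \ge\ 4\sqrt2\,C_L\left(\frac{\max\{\mu_1,\mu_2\}}{\min\{\mu_1,\mu_2\}}\right)^{1/2}\mathfrak g^2 .$$ Here, since $g_1,g_2$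 are defined only almost everywhere in time, $|g_1(t)-g_2(t)|\to0$ is understood up to a null set of times. -/

import Mathlib

noncomputable section

open MeasureTheory Filter Topology Set
open scoped ENNReal

namespace NudgedNSE

/-! ### Periodic vector fields and their Fourier coefficients -/

instance factTwoPiPos : Fact (0 < 2 * Real.pi) := ⟨Real.two_pi_pos⟩

/-- The periodic domain `Ω = (ℝ / 2πℤ)²`; its `volume` is Lebesgue measure, of total mass `4π²`. -/
abbrev Torus : Type := Fin 2 → AddCircle (2 * Real.pi)

/-- Euclidean `ℝ²`, the values of the vector fields. -/
abbrev Plane : Type := EuclideanSpace ℝ (Fin 2)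

/-- Real square integrable vector fields on the torus, with `|u|² = ∫_Ω |u(x)|² dx`. -/
abbrev L2Field : Type := Lp Plane 2 (volume : Measure Torus)

/-- The character `x ↦ exp (i k · x)`. -/
def character (k : Fin 2 → ℤ) (x : Torus) : ℂ := fourier (k 0) (x 0) * fourier (k 1) (x 1)

/-- `|k|²`, for a wavenumber `k ∈ ℤ²`. -/
def waveSq (k : Fin 2 → ℤ) : ℝ := (k 0 : ℝ) ^ 2 + (k 1 : ℝ) ^ 2

/-- The Fourier coefficient `(4π²)⁻¹ ∫_Ω f(x) exp (-i k · x) dx ∈ ℂ²` of a vector field `f`. -/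
def coeff (f : Torus → Plane) (k : Fin 2 → ℤ) : Fin 2 → ℂ := fun j =>
  ((4 * Real.pi ^ 2 : ℝ) : ℂ)⁻¹ * ∫ x : Torus, ((f x j : ℝ) : ℂ) * character (-k) x

/-! ### The spaces `H`, `V`, `D(A)` -/

/-- The space `H`: mean-free, divergence-free (in the sense of distributions) fields in `L²`. -/
def InH (u : L2Field) : Prop :=
  coeff u 0 = 0 ∧ ∀ k : Fin 2 → ℤ, ∑ j, (k j : ℂ) * coeff u k j = 0

/-- `w ∈ L²` is the weak (distributional) partial derivative `∂_j u`. -/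
def IsWeakDeriv (j : Fin 2) (u w : L2Field) : Prop :=
  ∀ k : Fin 2 → ℤ, coeff w k = (Complex.I * (k j : ℂ)) • coeff u k

open Classical in
/-- The weak derivative `∂_j u` (and `0` if `u` has no weak derivative in `L²`). -/
def partialDeriv (j : Fin 2) (u : L2Field) : L2Field :=
  if h : ∃ w, IsWeakDeriv j u w then h.choose else 0

/-- The space `V`: the fields in `H` with weak first derivatives in `L²`. -/
def InV (u : L2Field) : Prop := InH u ∧ ∀ j, ∃ w, IsWeakDeriv j u w

/-- The norm of `V`: `‖u‖² = ∑_j ∫_Ω |∂_j u(x)|² dx`. -/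
def normV (u : L2Field) : ℝ := √(∑ j, ‖partialDeriv j u‖ ^ 2)

/-- `w ∈ L²` equals `A u`, where the Stokes operator `A = -ℙΔ` acts as multiplication by `|k|²`. -/
def IsStokes (u w : L2Field) : Prop :=
  ∀ k : Fin 2 → ℤ, coeff w k = (waveSq k : ℂ) • coeff u k

/-- The domain `D(A)` of the Stokes operator in `H`. -/
def InDA (u : L2Field) : Prop := InH u ∧ ∃ w, IsStokes u w

open Classical in
/-- The Stokes operator on `D(A)` (and `0` off `D(A)`). -/
def stokes (u : L2Field) : L2Field :=
  if h : ∃ w, IsStokes u w then h.choose else 0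

/-! ### The bilinear term -/

/-- The vector field `(u · ∇) v = ∑_j u_j ∂_j v`. -/
def advection (u v : L2Field) (x : Torus) : Plane := ∑ j, u x j • partialDeriv j v x

/-- The Leray projection (onto mean-free, divergence-free fields), on Fourier coefficients:
`c_k ↦ c_k - |k|⁻² (k · c_k) k` for `k ≠ 0`, and the mean is removed. -/
def leray (c : (Fin 2 → ℤ) → Fin 2 → ℂ) (k : Fin 2 → ℤ) : Fin 2 → ℂ :=
  if k = 0 then 0
  else fun j => c k j - (∑ i, (k i : ℂ) * c k i) / (waveSq k : ℂ) * (k j : ℂ)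

/-- The periodic distribution `B(u,v) = ℙ((u · ∇) v)`, given by its Fourier coefficients. -/
def bilin (u v : L2Field) : (Fin 2 → ℤ) → Fin 2 → ℂ := leray (coeff (advection u v))

/-! ### Spectral projections -/

/-- The wavenumbers `k ∈ ℤ²` with `|k| ≤ N`. -/
def lowModes (N : ℝ) : Finset (Fin 2 → ℤ) :=
  (Fintype.piFinset fun _ : Fin 2 => Finset.Icc (-⌈N⌉) ⌈N⌉).filter fun k => √(waveSq k) ≤ N

/-- The trigonometric polynomial `x ↦ ∑_{|k| ≤ N} û_k exp (i k · x)`, which is real valued. -/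
def lowPart (N : ℝ) (u : L2Field) : C(Torus, Plane) where
  toFun x := WithLp.toLp 2 fun j => (∑ k ∈ lowModes N, coeff u k j * character k x).re
  continuous_toFun := by unfold character; fun_prop

/-- The projection `P_N` onto the wavenumbers `|k| ≤ N`. -/
def proj (N : ℝ) (u : L2Field) : L2Field := ContinuousMap.toLp 2 volume ℝ (lowPart N u)

/-! ### Forces and strong solutions -/

/-- `g ∈ L^∞(0,∞;H)`. -/
def IsForce (g : ℝ → L2Field) : Prop :=
  MemLp g ∞ (volume.restrict (Ioi 0)) ∧ ∀ᵐ t ∂(volume.restrict (Ioi (0 : ℝ))), InH (g t)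

/-- The generalized Grashof number `sup_{t ≥ 0} |g(t)| / ν²` (with the essential supremum). -/
def grashof (ν : ℝ) (g : ℝ → L2Field) : ℝ :=
  (eLpNorm g ∞ (volume.restrict (Ioi 0))).toReal / ν ^ 2

/-- `v ∈ C([0,T];V) ∩ L²(0,T;D(A))`, with `dv/dt ∈ L²(0,T;H)`, for all `T > 0`, and
`dv/dt + ν A v + B(v,v) = F` holds for almost every `t > 0`. -/
structure IsStrongSolution (ν : ℝ) (F v : ℝ → L2Field) : Prop where
  memV : ∀ t, 0 ≤ t → InV (v t)
  continuousV : ∀ t, 0 ≤ t → Tendsto (fun s => normV (v s - v t)) (𝓝[Ici 0] t) (𝓝 0)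
  memDA : ∀ᵐ t ∂(volume.restrict (Ioi (0 : ℝ))), InDA (v t)
  stokesL2 : ∀ T : ℝ, 0 < T → MemLp (fun t => stokes (v t)) 2 (volume.restrict (Ioc 0 T))
  equation : ∃ v' : ℝ → L2Field,
    (∀ T : ℝ, 0 < T → MemLp v' 2 (volume.restrict (Ioc 0 T))) ∧
    (∀ t, 0 ≤ t → v t = v 0 + ∫ s in (0 : ℝ)..t, v' s) ∧
    ∀ᵐ t ∂(volume.restrict (Ioi (0 : ℝ))), ∀ k : Fin 2 → ℤ,
      coeff (v' t) k + (ν : ℂ) • coeff (stokes (v t)) k + bilin (v t) (v t) k = coeff (F t) k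

/-! ### The mutual nudging intertwinement -/

/-- `(v₁, v₂)` is a global strong solution of the mutual nudging intertwinement with cut-off `M`. -/
def IsMutualNudging (ν μ₁ μ₂ M : ℝ) (g₁ g₂ v₁ v₂ : ℝ → L2Field) : Prop :=
  IsStrongSolution ν (fun t => g₁ t + μ₁ • (proj M (v₂ t) - proj M (v₁ t))) v₁ ∧
  IsStrongSolution ν (fun t => g₂ t + μ₂ • (proj M (v₁ t) - proj M (v₂ t))) v₂

/-- Self-synchronization assisted by the modes `|k| ≤ N`: if `|g₁(t) - g₂(t)| → 0` (off a null set
of times) and `|P_N v₁(t) - P_N v₂(t)| → 0`, then `|v₁(t) - v₂(t)| → 0`, for all solutions. -/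
def SelfSynchronousAssistedBy (N ν μ₁ μ₂ M : ℝ) (g₁ g₂ : ℝ → L2Field) : Prop :=
  Tendsto (fun t => ‖g₁ t - g₂ t‖) (atTop ⊓ ae volume) (𝓝 0) →
  ∀ v₁ v₂ : ℝ → L2Field, IsMutualNudging ν μ₁ μ₂ M g₁ g₂ v₁ v₂ →
    Tendsto (fun t => ‖proj N (v₁ t) - proj N (v₂ t)‖) atTop (𝓝 0) →
    Tendsto (fun t => ‖v₁ t - v₂ t‖) atTop (𝓝 0)

/-- `C` is a constant for the Ladyzhenskaya inequality `|u|_{L⁴}² ≤ C ‖u‖ |u|` on `V`. -/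
def IsLadyzhenskayaConstant (C : ℝ) : Prop :=
  0 < C ∧ ∀ u : L2Field, InV u →
    eLpNorm u 4 (volume : Measure Torus) ^ 2 ≤ ENNReal.ofReal (C * normV u * ‖u‖)

end NudgedNSE

end

noncomputable section

open MeasureTheory Filter Topology Set
open scoped ENNReal ComplexConjugate

namespace NudgedNSE

/-! ### Absolutely continuous functions of time -/

/-! Write `w = v₁ - v₂` and `G = 𝔤²`, and take `μ₁ ≤ μ₂`, as the symmetry of the system allows. In
the energy balance of `w` the nudging contributes `-(μ₁ + μ₂)|P_M w|² ≤ 0` and is dropped, which is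
why `M` plays no role. Since `B(v₁,v₁) - B(v₂,v₂) = B(w,v₁) + B(v₂,w)` and the second term is
orthogonal to `w`, Ladyzhenskaya's and Young's inequalities bound the nonlinearity by `ν‖w‖² +
(C²/ν)‖v₁‖²|w|²`. The other half of the dissipation damps the modes beyond `N` at rate `ν
max(N,1)²`; the `1` is available because `w` is mean-free. Up to an arbitrarily small loss in the
rate, this gives (`difference_rate_le`) `d|w|²/dt ≤ ((C²/ν)‖v₁‖² - ν max(N,1)²)|w|² + b(t)`, where
`b → 0` gathers `P_N w` and `g₁ - g₂`.

Only the time average of `‖v₁‖²` is then needed. With `θ = μ₁/μ₂ ≤ 1`, the nudging terms in the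
balance of `|v₁|² + θ|v₂|²` combine into `-2μ₁|P_M w|² ≤ 0`, so the average is asymptotically at
most `ν²G`, with no dependence on `μ₁, μ₂` (`exists_integral_enstrophy_le`). Gronwall's inequality
with a rate that is positive on average (`gronwall_average`) yields synchronization as soon as `C²G
< max(N,1)²`.

This is weaker than the hypothesis of (ii), of which only `N ≥ 4CG` is used. The linear bound is
compared with the quadratic one by replacing `C` with `min(C,3)`, as `3` is itself a Ladyzhenskaya
constant (`isLadyzhenskayaConstant_three`).

Rigour rests on Fourier series: Parseval's identity turns the coefficientwise equation into a weak
form in `L²`, and fields in `D(A)` are bounded, so that `(v · ∇)v` is square integrable and may be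
tested against `w`. -/

theorem absolutelyContinuousOnInterval_of_dist_le {X Y : Type*} [PseudoMetricSpace X]
    [PseudoMetricSpace Y] {f : ℝ → X} {g : ℝ → Y} {a b K : ℝ}
    (hg : AbsolutelyContinuousOnInterval g a b)
    (h : ∀ x ∈ uIcc a b, ∀ y ∈ uIcc a b, dist (f x) (f y) ≤ K * dist (g x) (g y)) :
    AbsolutelyContinuousOnInterval f a b := by
  have hg' : Tendsto (fun E : ℕ × (ℕ → ℝ × ℝ) =>
      K * ∑ i ∈ Finset.range E.1, dist (g (E.2 i).1) (g (E.2 i).2))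
      (AbsolutelyContinuousOnInterval.totalLengthFilter ⊓
        𝓟 (AbsolutelyContinuousOnInterval.disjWithin a b)) (𝓝 0) := by
    simpa using Tendsto.const_mul K hg
  refine squeeze_zero' (.of_forall fun E => Finset.sum_nonneg fun i _ => dist_nonneg) ?_ hg'
  refine eventually_inf_principal.2 (.of_forall fun E hE => ?_)
  rw [Finset.mul_sum]
  refine Finset.sum_le_sum fun i hi => ?_
  have := hE.1 i hi
  exact h _ this.1 _ this.2

theorem continuousOn_of_eq_integral {H : Type*} [NormedAddCommGroup H] [NormedSpace ℝ H]
    {v v' : ℝ → H} {t : ℝ} (ht : 0 ≤ t) (hv' : IntervalIntegrable v' volume 0 t)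
    (hv : ∀ s ∈ Icc 0 t, v s = v 0 + ∫ r in (0 : ℝ)..s, v' r) : ContinuousOn v (uIcc 0 t) := by
  have hu : uIcc 0 t = Icc 0 t := uIcc_of_le ht
  rw [hu]
  refine ContinuousOn.congr (f := fun s => v 0 + ∫ r in (0 : ℝ)..s, v' r) ?_ hv
  have := intervalIntegral.continuousOn_primitive_interval' hv' (left_mem_uIcc)
  rw [hu] at this
  exact continuousOn_const.add this

theorem intervalIntegrable_inner_continuousOn {H : Type*} [NormedAddCommGroup H]
    [InnerProductSpace ℝ H] {f v : ℝ → H} {a b : ℝ} (hf : IntervalIntegrable f volume a b)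
    (hv : ContinuousOn v (uIcc a b)) :
    IntervalIntegrable (fun s => inner ℝ (f s) (v s)) volume a b := by
  obtain ⟨C, hC⟩ := isCompact_uIcc.exists_bound_of_continuousOn hv
  rw [intervalIntegrable_iff] at hf ⊢
  have hvm : AEStronglyMeasurable v (volume.restrict (uIoc a b)) :=
    (hv.mono uIoc_subset_uIcc).aestronglyMeasurable measurableSet_uIoc
  refine (hf.norm.mul_const C).mono' (hf.aestronglyMeasurable.inner hvm) ?_
  refine (ae_restrict_mem measurableSet_uIoc).mono fun s hs => ?_
  refine (norm_inner_le_norm _ _).trans ?_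
  exact mul_le_mul_of_nonneg_left (hC s (uIoc_subset_uIcc hs)) (norm_nonneg _)

/-- The increments of `v` are dominated by those of the scalar primitive of `‖v'‖`. Hence `‖v‖²` is
absolutely continuous, and it is the integral of its almost everywhere derivative. -/
theorem norm_sq_eq_integral {H : Type*} [NormedAddCommGroup H] [InnerProductSpace ℝ H]
    [CompleteSpace H] {v v' : ℝ → H} {t : ℝ} (ht : 0 ≤ t)
    (hv' : IntervalIntegrable v' volume 0 t)
    (hv : ∀ s ∈ Icc 0 t, v s = v 0 + ∫ r in (0 : ℝ)..s, v' r) :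
    ‖v t‖ ^ 2 = ‖v 0‖ ^ 2 + ∫ s in (0 : ℝ)..t, 2 * inner ℝ (v' s) (v s) := by
  have hu : uIcc 0 t = Icc 0 t := uIcc_of_le ht
  have hsub : ∀ x ∈ Icc 0 t, IntervalIntegrable v' volume 0 x := fun x hx =>
    hv'.mono_set (by rw [hu, uIcc_of_le hx.1]; exact Icc_subset_Icc_right hx.2)
  have hcont := continuousOn_of_eq_integral ht hv' hv
  obtain ⟨C, hC⟩ := isCompact_uIcc.exists_bound_of_continuousOn hcont
  have hgAC : AbsolutelyContinuousOnInterval (fun x => ∫ r in (0 : ℝ)..x, ‖v' r‖) 0 t :=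
    hv'.norm.absolutelyContinuousOnInterval_intervalIntegral left_mem_uIcc
  have hdist : ∀ x ∈ uIcc 0 t, ∀ y ∈ uIcc 0 t,
      ‖v x - v y‖ ≤ dist (∫ r in (0 : ℝ)..x, ‖v' r‖) (∫ r in (0 : ℝ)..y, ‖v' r‖) := by
    intro x hx y hy
    rw [hu] at hx hy
    rw [hv x hx, hv y hy, add_sub_add_left_eq_sub,
      intervalIntegral.integral_interval_sub_left (hsub x hx) (hsub y hy), Real.dist_eq,
      intervalIntegral.integral_interval_sub_left (hsub x hx).norm (hsub y hy).norm]
    exact intervalIntegral.norm_integral_le_abs_integral_norm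
  have hAC : AbsolutelyContinuousOnInterval (fun s => ‖v s‖ ^ 2) 0 t := by
    refine absolutelyContinuousOnInterval_of_dist_le (K := C + C) hgAC fun x hx y hy => ?_
    rw [Real.dist_eq, sq_sub_sq, abs_mul]
    refine mul_le_mul ?_ ((abs_norm_sub_norm_le _ _).trans (hdist x hx y hy)) (abs_nonneg _) ?_
    · rw [abs_of_nonneg (by positivity)]
      exact add_le_add (hC x hx) (hC y hy)
    · linarith [hC x hx, norm_nonneg (v x)]
  have hder := hAC.integral_deriv_eq_sub
  have : ∫ s in (0 : ℝ)..t, 2 * inner ℝ (v' s) (v s) =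
      ∫ s in (0 : ℝ)..t, deriv (fun s => ‖v s‖ ^ 2) s := by
    refine intervalIntegral.integral_congr_ae ?_
    -- The formula for `v` is known only on `[0,t]`, so a two-sided derivative is not available at
    -- the endpoint.
    have h0 : ∀ᵐ x : ℝ, x ≠ t := by simp [ae_iff, measure_singleton]
    filter_upwards [hv'.ae_hasDerivAt_integral, h0] with x hx hxt hx'
    have hxI : x ∈ uIcc 0 t := uIoc_subset_uIcc hx'
    rw [uIoc_of_le ht] at hx'
    have h1 : HasDerivAt v (v' x) x := by
      have h2 := (hx hxI 0 left_mem_uIcc).const_add (v 0)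
      refine h2.congr_of_eventuallyEq ?_
      filter_upwards [Ioo_mem_nhds hx'.1 (lt_of_le_of_ne hx'.2 hxt)] with s hs
      exact hv s ⟨hs.1.le, hs.2.le⟩
    rw [h1.norm_sq.deriv, real_inner_comm]
  rw [this, hder]; ring

/-- A Gronwall inequality for a linear differential inequality whose rate `κ - c(t)` is positive
on average. -/
theorem gronwall_average {y h c : ℝ → ℝ} {s t κ κ' K ε : ℝ} (hst : s ≤ t)
    (hh : IntervalIntegrable h volume s t) (hc : IntervalIntegrable c volume s t)
    (hy : ∀ r ∈ Icc s t, y r = y s + ∫ x in s..r, h x)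
    (hy0 : 0 ≤ y s) (hε : 0 ≤ ε)
    (hle : ∀ᵐ r, r ∈ Ioc s t → h r ≤ (c r - κ) * y r + ε)
    (hcK : ∀ r ∈ Icc s t, ∫ x in r..t, c x ≤ K + κ' * (t - r)) (hκ : κ' < κ) :
    y t ≤ Real.exp K * (Real.exp (-(κ - κ') * (t - s)) * y s + ε / (κ - κ')) := by
  have hu : uIcc s t = Icc s t := uIcc_of_le hst
  set A : ℝ → ℝ := fun r => ∫ x in s..r, (κ - c x) with hA
  have hκc : IntervalIntegrable (fun x => κ - c x) volume s t := intervalIntegrable_const.sub hc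
  have hsub : ∀ r ∈ Icc s t, IntervalIntegrable c volume r t := fun r hr =>
    hc.mono_set (by rw [hu, uIcc_of_le hr.2]; exact Icc_subset_Icc_left hr.1)
  have hsub' : ∀ r ∈ Icc s t, IntervalIntegrable (fun x => κ - c x) volume s r := fun r hr =>
    hκc.mono_set (by rw [hu, uIcc_of_le hr.1]; exact Icc_subset_Icc_right hr.2)
  have hAt : ∀ r ∈ Icc s t, A r - A t ≤ K - (κ - κ') * (t - r) := by
    intro r hr
    have h1 : A r - A t = - ∫ x in r..t, (κ - c x) := by
      rw [hA, ← intervalIntegral.integral_symm]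
      exact intervalIntegral.integral_interval_sub_left (hsub' r hr) hκc
    rw [h1, intervalIntegral.integral_sub intervalIntegrable_const (hsub r hr),
      intervalIntegral.integral_const, smul_eq_mul]
    nlinarith [hcK r hr]
  have hAAC : AbsolutelyContinuousOnInterval A s t :=
    hκc.absolutelyContinuousOnInterval_intervalIntegral left_mem_uIcc
  have hyAC : AbsolutelyContinuousOnInterval y s t := by
    refine absolutelyContinuousOnInterval_of_dist_le (K := 1)
      (hh.absolutelyContinuousOnInterval_intervalIntegral left_mem_uIcc) fun x hx z hz => ?_
    rw [hu] at hx hz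
    rw [hy x hx, hy z hz, dist_add_left, one_mul]
  obtain ⟨B, hB⟩ := hAAC.exists_bound
  have heAC : AbsolutelyContinuousOnInterval (fun r => Real.exp (A r)) s t := by
    refine absolutelyContinuousOnInterval_of_dist_le (K := Real.exp B) hAAC fun x hx z hz => ?_
    have hx' := (abs_le.1 (hB x hx)).2
    have hz' := (abs_le.1 (hB z hz)).2
    -- `exp` is Lipschitz with constant `exp B` on `(-∞, B]`, by the tangent bound `exp(q - p) ≥ 1 +
    -- (q - p)`.
    have key : ∀ p q : ℝ, p ≤ B → |p - q| * Real.exp B ≥ Real.exp p - Real.exp q := by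
      intro p q hp
      have h1 : Real.exp q = Real.exp p * Real.exp (q - p) := by rw [← Real.exp_add]; ring_nf
      have h2 := Real.add_one_le_exp (q - p)
      have h3 := Real.exp_le_exp.2 hp
      have h4 := Real.exp_pos p
      have h5 := le_abs_self (p - q)
      have h6 := abs_nonneg (p - q)
      rw [h1]
      nlinarith [mul_le_mul_of_nonneg_left h2 h4.le, mul_le_mul_of_nonneg_left h3 h6,
        mul_le_mul_of_nonneg_right h5 h4.le]
    rw [Real.dist_eq, Real.dist_eq, abs_le]
    constructor
    · have := key (A z) (A x) hz'
      rw [abs_sub_comm] at this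
      linarith
    · linarith [key (A x) (A z) hx']
  have hz := (heAC.fun_mul hyAC).integral_deriv_eq_sub
  have hA0 : A s = 0 := by simp [hA]
  have heint : IntervalIntegrable (fun r => Real.exp (A r)) volume s t :=
    heAC.continuousOn.intervalIntegrable
  have hmono : ∫ r in s..t, deriv (fun r => Real.exp (A r) * y r) r ≤
      ∫ r in s..t, ε * Real.exp (A r) := by
    refine intervalIntegral.integral_mono_ae_restrict hst
      (heAC.fun_mul hyAC).intervalIntegrable_deriv (heint.const_mul ε) ?_
    have h0 : ∀ᵐ x : ℝ, x ≠ t := by simp [ae_iff, measure_singleton]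
    have h0' : ∀ᵐ x : ℝ, x ≠ s := by simp [ae_iff, measure_singleton]
    refine (ae_restrict_iff' measurableSet_Icc).2 ?_
    filter_upwards [hκc.ae_hasDerivAt_integral, hh.ae_hasDerivAt_integral, h0, h0', hle]
      with r h1 h2 h3 h4 h5 hr
    have hr' : r ∈ uIcc s t := by rwa [hu]
    have hlt : s < r := lt_of_le_of_ne hr.1 (Ne.symm h4)
    have hrt : r < t := lt_of_le_of_ne hr.2 h3
    have hyd : HasDerivAt y (h r) r := by
      refine ((h2 hr' s left_mem_uIcc).const_add (y s)).congr_of_eventuallyEq ?_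
      filter_upwards [Ioo_mem_nhds hlt hrt] with x hx
      exact hy x ⟨hx.1.le, hx.2.le⟩
    have hAd : HasDerivAt A (κ - c r) r := h1 hr' s left_mem_uIcc
    rw [(hAd.exp.fun_mul hyd).deriv]
    have := mul_le_mul_of_nonneg_left (h5 ⟨hlt, hr.2⟩) (Real.exp_pos (A r)).le
    linarith
  rw [hz, hA0, Real.exp_zero, one_mul] at hmono
  have hδ : 0 < κ - κ' := sub_pos.2 hκ
  have hI : ∫ r in s..t, ε * Real.exp (A r) ≤
      Real.exp (A t) * (Real.exp K * (ε / (κ - κ'))) := by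
    have h1 : ∫ r in s..t, ε * Real.exp (A r) ≤
        ∫ r in s..t, (ε * Real.exp (A t) * Real.exp K) * Real.exp (-(κ - κ') * (t - r)) := by
      refine intervalIntegral.integral_mono_on hst (heint.const_mul ε)
        (Continuous.intervalIntegrable (by fun_prop) _ _) fun r hr => ?_
      have : Real.exp (A r) ≤ Real.exp (A t) * Real.exp K * Real.exp (-(κ - κ') * (t - r)) := by
        rw [← Real.exp_add, ← Real.exp_add]
        exact Real.exp_le_exp.2 (by linarith [hAt r hr])
      calc ε * Real.exp (A r) ≤ _ := mul_le_mul_of_nonneg_left this hε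
        _ = _ := by ring
    have h2 : ∫ r in s..t, Real.exp (-(κ - κ') * (t - r)) =
        (1 - Real.exp (-(κ - κ') * (t - s))) / (κ - κ') := by
      have hd : ∀ r ∈ uIcc s t, HasDerivAt
          (fun r => Real.exp (-(κ - κ') * (t - r)) / (κ - κ'))
          (Real.exp (-(κ - κ') * (t - r))) r := by
        intro r _
        have h3 : HasDerivAt (fun r => -(κ - κ') * (t - r)) (κ - κ') r := by
          have := ((hasDerivAt_id r).const_sub t).const_mul (-(κ - κ'))
          simpa using this
        have := (h3.exp).div_const (κ - κ')
        rwa [mul_div_assoc, div_self hδ.ne', mul_one] at this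
      rw [intervalIntegral.integral_eq_sub_of_hasDerivAt hd
        (Continuous.intervalIntegrable (by fun_prop) _ _)]
      simp only [sub_self, mul_zero, Real.exp_zero]
      ring
    rw [intervalIntegral.integral_const_mul (ε * Real.exp (A t) * Real.exp K), h2] at h1
    refine h1.trans ?_
    have h4 : (1 - Real.exp (-(κ - κ') * (t - s))) / (κ - κ') ≤ 1 / (κ - κ') := by
      gcongr
      linarith [Real.exp_pos (-(κ - κ') * (t - s))]
    calc _ ≤ ε * Real.exp (A t) * Real.exp K * (1 / (κ - κ')) :=
          mul_le_mul_of_nonneg_left h4 (by positivity)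
      _ = _ := by ring
  have h5 : Real.exp (A t) * y t ≤
      Real.exp (A t) * (Real.exp K * (Real.exp (-(κ - κ') * (t - s)) * y s + ε / (κ - κ'))) := by
    have h6 : (1 : ℝ) ≤ Real.exp (A t) * (Real.exp K * Real.exp (-(κ - κ') * (t - s))) := by
      rw [← Real.exp_add, ← Real.exp_add, Real.one_le_exp_iff]
      have := hAt s ⟨le_rfl, hst⟩
      rw [hA0] at this
      linarith
    have := mul_le_mul_of_nonneg_right h6 hy0
    rw [one_mul] at this
    nlinarith
  exact le_of_mul_le_mul_left h5 (Real.exp_pos _)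

/-! ### Characters and Parseval's identity -/

theorem character_zero (x : Torus) : character 0 x = 1 := by simp [character]

theorem character_add (k l : Fin 2 → ℤ) (x : Torus) :
    character (k + l) x = character k x * character l x := by
  simp only [character, Pi.add_apply, fourier_add]; ring

theorem character_neg (k : Fin 2 → ℤ) (x : Torus) : character (-k) x = conj (character k x) := by
  simp only [character, Pi.neg_apply, fourier_neg, map_mul]

theorem norm_character (k : Fin 2 → ℤ) (x : Torus) : ‖character k x‖ = 1 := by
  have h : ∀ (n : ℤ) (y : AddCircle (2 * Real.pi)), ‖(fourier n y : ℂ)‖ = 1 :=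
    fun n y => Circle.norm_coe _
  rw [character, norm_mul, h, h, mul_one]

theorem character_eq_prod (k : Fin 2 → ℤ) (x : Torus) :
    character k x = ∏ i, fourier (k i) (x i) := by
  simp [character, Fin.prod_univ_two]

@[fun_prop]
theorem continuous_character (k : Fin 2 → ℤ) : Continuous (character k) := by
  unfold character; fun_prop

/-- The character `x ↦ exp (i k · x)` as a continuous map. -/
def characterMap (k : Fin 2 → ℤ) : C(Torus, ℂ) := ⟨character k, continuous_character k⟩

theorem integral_fourier (n : ℤ) :
    ∫ x : AddCircle (2 * Real.pi), (fourier n x : ℂ) = if n = 0 then 2 * Real.pi else 0 := by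
  split_ifs with h
  · subst h
    simp only [fourier_zero, integral_const, measureReal_def, AddCircle.measure_univ, Complex.real_smul,
      mul_one]
    rw [ENNReal.toReal_ofReal Real.two_pi_pos.le]
  · have := (orthonormal_iff_ite.1 (orthonormal_fourier (T := 2 * Real.pi))) 0 n
    rw [if_neg (Ne.symm h), ContinuousMap.inner_toLp] at this
    rw [AddCircle.volume_eq_smul_haarAddCircle, integral_smul_measure]
    simp only [fourier_zero, map_one, mul_one] at this
    rw [this, smul_zero]; simp

theorem integral_character (k : Fin 2 → ℤ) :
    ∫ x : Torus, character k x = if k = 0 then 4 * (Real.pi : ℂ) ^ 2 else 0 := by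
  simp only [character_eq_prod]
  rw [integral_fintype_prod_volume_eq_prod (fun i (x : AddCircle (2 * Real.pi)) => (fourier (k i) x : ℂ))]
  simp only [integral_fourier, Fin.prod_univ_two]
  by_cases h0 : k 0 = 0 <;> by_cases h1 : k 1 = 0 <;>
    simp [h0, h1, funext_iff, Fin.forall_fin_two]
  ring

theorem integral_character_mul (k l : Fin 2 → ℤ) :
    ∫ x : Torus, character k x * character (-l) x = if k = l then 4 * (Real.pi : ℂ) ^ 2 else 0 := by
  simp only [← character_add, integral_character, ← sub_eq_add_neg, sub_eq_zero]

/-- The star subalgebra of trigonometric polynomials. -/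
def trigSubalgebra : StarSubalgebra ℂ C(Torus, ℂ) where
  toSubalgebra := Algebra.adjoin ℂ (range characterMap)
  star_mem' := by
    change Algebra.adjoin ℂ (range characterMap) ≤ star (Algebra.adjoin ℂ (range characterMap))
    refine Algebra.adjoin_le ?_
    rintro _ ⟨n, rfl⟩
    refine Algebra.subset_adjoin ⟨-n, ?_⟩
    ext1 x
    exact character_neg n x

theorem trigSubalgebra_coe :
    trigSubalgebra.toSubalgebra.toSubmodule = Submodule.span ℂ (range characterMap) := by
  apply Algebra.adjoin_eq_span_of_subset
  refine .trans (fun x ↦ Submonoid.closure_induction (fun _ ↦ id) ⟨0, ?_⟩ ?_) Submodule.subset_span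
  · ext z
    exact character_zero z
  · rintro _ _ _ _ ⟨m, rfl⟩ ⟨n, rfl⟩
    refine ⟨m + n, ?_⟩
    ext z
    exact character_add m n z

theorem trigSubalgebra_separatesPoints : trigSubalgebra.SeparatesPoints := by
  intro x y hxy
  rw [Ne, funext_iff, not_forall] at hxy
  obtain ⟨i, hi⟩ := hxy
  refine ⟨_, ⟨characterMap (Pi.single i 1), Algebra.subset_adjoin ⟨Pi.single i 1, rfl⟩, rfl⟩, ?_⟩
  have key : ∀ z : Torus, character (Pi.single i 1) z = (AddCircle.toCircle (z i) : ℂ) := by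
    intro z
    fin_cases i <;> simp [character]
  change character _ x ≠ character _ y
  rw [key, key]
  exact fun h => hi (AddCircle.injective_toCircle Real.two_pi_pos.ne' (Circle.coe_injective h))

/-- Stone–Weierstrass: trigonometric polynomials form a star subalgebra that separates points. -/
theorem span_characterMap_closure_eq_top :
    (Submodule.span ℂ (range characterMap)).topologicalClosure = ⊤ := by
  rw [← trigSubalgebra_coe]
  exact congr_arg (Subalgebra.toSubmodule <| StarSubalgebra.toSubalgebra ·)
    (ContinuousMap.starSubalgebra_topologicalClosure_eq_top_of_separatesPoints _
      trigSubalgebra_separatesPoints)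

/-- The normalized characters, as elements of `L²`. -/
def characterLp (k : Fin 2 → ℤ) : Lp ℂ 2 (volume : Measure Torus) :=
  ContinuousMap.toLp (E := ℂ) 2 volume ℂ (((2 * Real.pi : ℝ) : ℂ)⁻¹ • characterMap k)

theorem coeFn_characterLp (k : Fin 2 → ℤ) :
    characterLp k =ᵐ[volume] fun x => ((2 * Real.pi : ℝ) : ℂ)⁻¹ * character k x :=
  ContinuousMap.coeFn_toLp volume _

theorem orthonormal_characterLp : Orthonormal ℂ characterLp := by
  rw [orthonormal_iff_ite]
  intro m n
  simp only [characterLp, ContinuousMap.inner_toLp, ContinuousMap.smul_apply, smul_eq_mul]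
  have : ∀ x : Torus, (((2 * Real.pi : ℝ) : ℂ)⁻¹ * characterMap n x) *
      conj (((2 * Real.pi : ℝ) : ℂ)⁻¹ * characterMap m x) =
      (((2 * Real.pi : ℝ) : ℂ)⁻¹ ^ 2) * (character n x * character (-m) x) := by
    intro x
    change (_ * character n x) * conj (_ * character m x) = _
    rw [character_neg, map_mul, map_inv₀, Complex.conj_ofReal]
    ring
  simp only [this]
  rw [integral_const_mul, integral_character_mul]
  have hpi : (Real.pi : ℂ) ≠ 0 := by exact_mod_cast Real.pi_ne_zero
  by_cases h : m = n
  · subst h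
    simp only [if_true]
    push_cast
    field_simp
    norm_num
  · rw [if_neg (Ne.symm h), if_neg h, mul_zero]

theorem span_characterLp_closure_eq_top :
    (Submodule.span ℂ (range characterLp)).topologicalClosure = ⊤ := by
  have h1 : (Submodule.span ℂ (range fun k => ContinuousMap.toLp (E := ℂ) 2 (volume : Measure Torus) ℂ
      (characterMap k))).topologicalClosure = ⊤ := by
    simpa only [Submodule.map_span, ContinuousLinearMap.coe_coe, ← range_comp, Function.comp_def] using
      (ContinuousMap.toLp_denseRange ℂ (volume : Measure Torus) ℂ
        (p := 2) (by simp)).topologicalClosure_map_submodule span_characterMap_closure_eq_top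
  rw [eq_top_iff, ← h1]
  refine Submodule.topologicalClosure_mono (Submodule.span_le.2 ?_)
  rintro _ ⟨k, rfl⟩
  have h2 : ContinuousMap.toLp (E := ℂ) 2 (volume : Measure Torus) ℂ (characterMap k) =
      ((2 * Real.pi : ℝ) : ℂ) • characterLp k := by
    have h3 : ((2 * Real.pi : ℝ) : ℂ) ≠ 0 := by exact_mod_cast Real.two_pi_pos.ne'
    rw [characterLp, map_smul, smul_smul, mul_inv_cancel₀ h3, one_smul]
  simp only [h2]
  exact Submodule.smul_mem _ _ (Submodule.subset_span ⟨k, rfl⟩)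

/-- The characters form a Hilbert basis of `L²`. -/
def characterBasis : HilbertBasis (Fin 2 → ℤ) ℂ (Lp ℂ 2 (volume : Measure Torus)) :=
  HilbertBasis.mk orthonormal_characterLp span_characterLp_closure_eq_top.ge

/-- The Fourier coefficient of a scalar function. -/
def scalarCoeff (f : Torus → ℝ) (k : Fin 2 → ℤ) : ℂ :=
  ((4 * Real.pi ^ 2 : ℝ) : ℂ)⁻¹ * ∫ x : Torus, (f x : ℂ) * character (-k) x

theorem inner_characterLp {f : Torus → ℝ} (hf : MemLp (fun x => (f x : ℂ)) 2 volume)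
    (k : Fin 2 → ℤ) : inner ℂ (characterLp k) (hf.toLp _) = ((2 * Real.pi : ℝ) : ℂ) * scalarCoeff f k := by
  rw [L2.inner_def]
  have : ∫ x, inner ℂ (characterLp k x) (hf.toLp _ x) =
      ∫ x, ((2 * Real.pi : ℝ) : ℂ)⁻¹ * ((f x : ℂ) * character (-k) x) := by
    refine integral_congr_ae ?_
    filter_upwards [coeFn_characterLp k, hf.coeFn_toLp] with x h1 h2
    rw [h1, h2, RCLike.inner_apply, map_mul, map_inv₀, Complex.conj_ofReal, character_neg]
    ring
  rw [this, integral_const_mul, scalarCoeff]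
  have hpi : (Real.pi : ℂ) ≠ 0 := by exact_mod_cast Real.pi_ne_zero
  push_cast
  field_simp
  ring

/-- The factor `4π²` arises because pairing with a normalized character gives `2π` times the Fourier
coefficient. -/
theorem hasSum_scalarCoeff {f g : Torus → ℝ} (hf : MemLp f 2 volume) (hg : MemLp g 2 volume) :
    HasSum (fun k => ((4 * Real.pi ^ 2 : ℝ) : ℂ) * (conj (scalarCoeff f k) * scalarCoeff g k))
      ((∫ x, f x * g x : ℝ) : ℂ) := by
  have hf' : MemLp (fun x => (f x : ℂ)) 2 volume := hf.ofReal
  have hg' : MemLp (fun x => (g x : ℂ)) 2 volume := hg.ofReal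
  have := characterBasis.hasSum_inner_mul_inner (hf'.toLp _) (hg'.toLp _)
  have hb : ∀ k, characterBasis k = characterLp k := fun k => by
    rw [characterBasis, HilbertBasis.coe_mk]
  simp only [hb, inner_characterLp hg'] at this
  rw [L2.inner_def] at this
  have h1 : ∫ x, inner ℂ (hf'.toLp _ x) (hg'.toLp _ x) = ((∫ x, f x * g x : ℝ) : ℂ) := by
    rw [← integral_complex_ofReal]
    refine integral_congr_ae ?_
    filter_upwards [hf'.coeFn_toLp, hg'.coeFn_toLp] with x h1 h2
    rw [h1, h2, RCLike.inner_apply, Complex.conj_ofReal]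
    push_cast; ring
  rw [h1] at this
  refine this.congr_fun fun k => ?_
  rw [← inner_conj_symm, inner_characterLp hf', map_mul, Complex.conj_ofReal]
  push_cast; ring

theorem memLp_component {u : Torus → Plane} {p : ℝ≥0∞} (hu : MemLp u p (volume : Measure Torus))
    (j : Fin 2) : MemLp (fun x => u x j) p volume := by
  exact (EuclideanSpace.proj j : Plane →L[ℝ] ℝ).comp_memLp' hu

theorem plane_inner (a b : Plane) : inner ℝ a b = ∑ j, a j * b j := by
  simp [PiLp.inner_apply, mul_comm]

/-- **Parseval's identity** for vector fields. -/
theorem hasSum_coeff (u w : L2Field) :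
    HasSum (fun k => ((4 * Real.pi ^ 2 : ℝ) : ℂ) * ∑ j, conj (coeff u k j) * coeff w k j)
      ((inner ℝ u w : ℝ) : ℂ) := by
  have h := hasSum_sum (s := Finset.univ) fun (j : Fin 2) _ =>
    hasSum_scalarCoeff (memLp_component (Lp.memLp u) j) (memLp_component (Lp.memLp w) j)
  have h1 : ((inner ℝ u w : ℝ) : ℂ) = ∑ j, ((∫ x, u x j * w x j : ℝ) : ℂ) := by
    rw [L2.inner_def]
    simp only [plane_inner]
    rw [integral_finsetSum]
    · push_cast; rfl
    · intro j _
      exact (memLp_component (Lp.memLp u) j).integrable_mul (memLp_component (Lp.memLp w) j)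
  rw [h1]
  refine h.congr_fun fun k => ?_
  rw [Finset.mul_sum]
  rfl

theorem hasSum_inner (u w : L2Field) :
    HasSum (fun k => 4 * Real.pi ^ 2 * ∑ j, (conj (coeff u k j) * coeff w k j).re)
      (inner ℝ u w : ℝ) := by
  have := Complex.hasSum_re (hasSum_coeff u w)
  simpa only [Complex.re_ofReal_mul, Complex.re_sum, Complex.ofReal_re] using this

theorem hasSum_norm_sq (u : L2Field) :
    HasSum (fun k => 4 * Real.pi ^ 2 * ∑ j, ‖coeff u k j‖ ^ 2) (‖u‖ ^ 2) := by
  have := hasSum_inner u u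
  rw [real_inner_self_eq_norm_sq] at this
  refine this.congr_fun fun k => ?_
  congr 1
  refine Finset.sum_congr rfl fun j _ => ?_
  rw [← Complex.normSq_eq_conj_mul_self, Complex.ofReal_re, Complex.normSq_eq_norm_sq]

/-! ### Linearity and projections -/

theorem integrable_mul_character {f : Torus → ℝ} (hf : Integrable f volume) (k : Fin 2 → ℤ) :
    Integrable (fun x => (f x : ℂ) * character k x) volume := by
  refine hf.ofReal.mul_bdd (c := 1) (continuous_character k).aestronglyMeasurable ?_
  exact .of_forall fun x => (norm_character k x).le

theorem integrable_component {u : Torus → Plane} (hu : Integrable u (volume : Measure Torus))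
    (j : Fin 2) : Integrable (fun x => u x j) volume :=
  memLp_one_iff_integrable.1 (memLp_component (memLp_one_iff_integrable.2 hu) j)

theorem integrable_field (u : L2Field) : Integrable u (volume : Measure Torus) :=
  (Lp.memLp u).integrable (by norm_num)

theorem coeff_congr {f g : Torus → Plane} (h : f =ᵐ[volume] g) : coeff f = coeff g := by
  funext k j
  unfold coeff
  congr 1
  refine integral_congr_ae ?_
  filter_upwards [h] with x hx
  rw [hx]

theorem coeff_fun_sub {f g : Torus → Plane} (hf : Integrable f volume) (hg : Integrable g volume)
    (k : Fin 2 → ℤ) : coeff (f - g) k = coeff f k - coeff g k := by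
  funext j
  simp only [coeff, Pi.sub_apply]
  rw [← mul_sub, ← integral_sub (integrable_mul_character (integrable_component hf j) _)
    (integrable_mul_character (integrable_component hg j) _)]
  congr 2
  funext x
  simp only [PiLp.sub_apply]
  push_cast; ring

theorem coeff_fun_add {f g : Torus → Plane} (hf : Integrable f volume) (hg : Integrable g volume)
    (k : Fin 2 → ℤ) : coeff (f + g) k = coeff f k + coeff g k := by
  funext j
  simp only [coeff, Pi.add_apply]
  rw [← mul_add, ← integral_add (integrable_mul_character (integrable_component hf j) _)
    (integrable_mul_character (integrable_component hg j) _)]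
  congr 2
  funext x
  simp only [PiLp.add_apply]
  push_cast; ring

theorem coeff_sub (u w : L2Field) (k : Fin 2 → ℤ) : coeff (u - w : L2Field) k = coeff u k - coeff w k := by
  rw [coeff_congr (Lp.coeFn_sub u w), coeff_fun_sub (integrable_field u) (integrable_field w)]

theorem coeff_add (u w : L2Field) (k : Fin 2 → ℤ) : coeff (u + w : L2Field) k = coeff u k + coeff w k := by
  rw [coeff_congr (Lp.coeFn_add u w), coeff_fun_add (integrable_field u) (integrable_field w)]

theorem coeff_smul (c : ℝ) (u : L2Field) (k : Fin 2 → ℤ) :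
    coeff (c • u : L2Field) k = (c : ℂ) • coeff u k := by
  rw [coeff_congr (Lp.coeFn_smul c u)]
  funext j
  simp only [coeff, Pi.smul_apply, PiLp.smul_apply, smul_eq_mul, Complex.ofReal_mul]
  simp only [mul_assoc]
  rw [integral_const_mul]
  ring

/-- Completeness of the characters. It makes weak derivatives and `A u` unique, so that the chosen
representatives can be computed mode by mode. -/
theorem field_ext {u w : L2Field} (h : ∀ k, coeff u k = coeff w k) : u = w := by
  have h1 := hasSum_norm_sq (u - w)
  have h2 : (fun k => 4 * Real.pi ^ 2 * ∑ j, ‖coeff (u - w : L2Field) k j‖ ^ 2) = fun _ => 0 := by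
    funext k
    rw [coeff_sub, h, sub_self]
    simp
  rw [h2] at h1
  have h3 := h1.unique hasSum_zero
  exact sub_eq_zero.1 (norm_eq_zero.1 (pow_eq_zero_iff two_ne_zero |>.1 h3))

/-! ### Conjugate symmetry of the coefficients, and the projections `P_N` -/

theorem coeff_neg_mode (f : Torus → Plane) (k : Fin 2 → ℤ) (j : Fin 2) :
    coeff f (-k) j = conj (coeff f k j) := by
  simp only [coeff, map_mul, map_inv₀, Complex.conj_ofReal, ← integral_conj, ← character_neg]

theorem waveSq_neg (k : Fin 2 → ℤ) : waveSq (-k) = waveSq k := by simp [waveSq]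

theorem waveSq_nonneg (k : Fin 2 → ℤ) : 0 ≤ waveSq k := by unfold waveSq; positivity

/-- The box in the definition only ensures finiteness: `|k_j| ≤ |k| ≤ N ≤ ⌈N⌉`. -/
theorem mem_lowModes {N : ℝ} {k : Fin 2 → ℤ} : k ∈ lowModes N ↔ √(waveSq k) ≤ N := by
  simp only [lowModes, Finset.mem_filter, Fintype.mem_piFinset, Finset.mem_Icc,
    and_iff_right_iff_imp]
  intro h j
  have h1 : |(k j : ℝ)| ≤ √(waveSq k) := by
    refine Real.abs_le_sqrt ?_
    fin_cases j <;> simp only [waveSq, Fin.zero_eta, Fin.mk_one] <;> nlinarith [sq_nonneg (k 0 : ℝ), sq_nonneg (k 1 : ℝ)]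
  have h2 := (h1.trans h).trans (Int.le_ceil N)
  rw [abs_le] at h2
  exact ⟨by exact_mod_cast h2.1, by exact_mod_cast h2.2⟩

theorem neg_mem_lowModes {N : ℝ} {k : Fin 2 → ℤ} : -k ∈ lowModes N ↔ k ∈ lowModes N := by
  rw [mem_lowModes, mem_lowModes, waveSq_neg]

/-- Taking the real part loses nothing: the coefficients of a real field satisfy `û_{-k} = conj
û_k`, and the set of modes is invariant under `k ↦ -k`. -/
theorem ofReal_lowPart (N : ℝ) (u : L2Field) (x : Torus) (j : Fin 2) :
    ((lowPart N u x j : ℝ) : ℂ) = ∑ k ∈ lowModes N, coeff u k j * character k x := by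
  have h : conj (∑ k ∈ lowModes N, coeff u k j * character k x) =
      ∑ k ∈ lowModes N, coeff u k j * character k x := by
    rw [map_sum]
    refine Finset.sum_nbij' (fun k => -k) (fun k => -k) (fun k hk => neg_mem_lowModes.2 hk)
      (fun k hk => neg_mem_lowModes.2 hk) (fun k _ => neg_neg k) (fun k _ => neg_neg k) fun k _ => ?_
    rw [map_mul, ← coeff_neg_mode, ← character_neg]
  rw [← Complex.conj_eq_iff_re.1 h]
  rfl

theorem coeff_proj (N : ℝ) (u : L2Field) (k : Fin 2 → ℤ) :
    coeff (proj N u) k = if k ∈ lowModes N then coeff u k else 0 := by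
  rw [proj, coeff_congr (ContinuousMap.coeFn_toLp (𝕜 := ℝ) volume (lowPart N u))]
  funext j
  simp only [coeff, ofReal_lowPart]
  have hpi : (Real.pi : ℂ) ≠ 0 := by exact_mod_cast Real.pi_ne_zero
  simp only [Finset.sum_mul, mul_assoc]
  rw [integral_finsetSum]
  · simp only [integral_const_mul, integral_character_mul, mul_ite, mul_zero, Finset.sum_ite_eq']
    split_ifs
    · simp only [coeff]
      push_cast
      field_simp
    · simp
  · intro l _
    refine Integrable.const_mul ?_ _
    exact Continuous.integrable_of_hasCompactSupport (by fun_prop) (HasCompactSupport.of_compactSpace _)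

theorem proj_sub (N : ℝ) (u w : L2Field) : proj N (u - w) = proj N u - proj N w := by
  refine field_ext fun k => ?_
  simp only [coeff_sub, coeff_proj]
  split_ifs <;> simp

theorem inner_proj_left (N : ℝ) (u w : L2Field) :
    inner ℝ (proj N u) w = inner ℝ (proj N u) (proj N w) := by
  refine (hasSum_inner _ _).unique ((hasSum_inner _ _).congr_fun fun k => ?_)
  simp only [coeff_proj]
  split_ifs <;> simp

theorem norm_sub_proj_sq (N : ℝ) (u : L2Field) :
    ‖u - proj N u‖ ^ 2 = ‖u‖ ^ 2 - ‖proj N u‖ ^ 2 := by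
  rw [norm_sub_sq_real, real_inner_comm, inner_proj_left, real_inner_self_eq_norm_sq]
  ring

theorem norm_proj_le (N : ℝ) (u : L2Field) : ‖proj N u‖ ≤ ‖u‖ := by
  refine le_of_sq_le_sq ?_ (norm_nonneg _)
  nlinarith [norm_sub_proj_sq N u, sq_nonneg ‖u - proj N u‖]

theorem norm_proj_sq (N : ℝ) (u : L2Field) :
    ‖proj N u‖ ^ 2 = ∑ k ∈ lowModes N, 4 * Real.pi ^ 2 * ∑ j, ‖coeff u k j‖ ^ 2 := by
  refine (hasSum_norm_sq _).unique ?_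
  have : HasSum (fun k => 4 * Real.pi ^ 2 * ∑ j, ‖coeff (proj N u) k j‖ ^ 2) _ :=
    hasSum_sum_of_ne_finset_zero (s := lowModes N) (fun k hk => by simp [coeff_proj, hk])
  rw [Finset.sum_congr rfl fun k hk => by rw [coeff_proj, if_pos hk]] at this
  exact this

theorem tendsto_proj (u : L2Field) : Tendsto (fun n : ℕ => proj n u) atTop (𝓝 u) := by
  rw [tendsto_iff_norm_sub_tendsto_zero]
  have h1 : Tendsto (fun n : ℕ => lowModes n) atTop atTop := by
    refine tendsto_atTop_finset_of_monotone ?_ fun k => ?_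
    · intro m n hmn k hk
      rw [mem_lowModes] at hk ⊢
      exact hk.trans (by exact_mod_cast hmn)
    · obtain ⟨n, hn⟩ := exists_nat_ge (√(waveSq k))
      exact ⟨n, mem_lowModes.2 hn⟩
  have h2 := (hasSum_norm_sq u).comp h1
  have h3 : Tendsto (fun n : ℕ => ‖u - proj n u‖ ^ 2) atTop (𝓝 0) := by
    simp only [norm_sub_proj_sq, norm_proj_sq]
    rw [← sub_self (‖u‖ ^ 2)]
    exact h2.const_sub (‖u‖ ^ 2)
  have h4 := (Real.continuous_sqrt.tendsto 0).comp h3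
  simpa [Function.comp_def, norm_sub_rev] using h4

/-! ### The spaces `V` and `D(A)` -/

theorem IsWeakDeriv.eq {j : Fin 2} {u w w' : L2Field} (h : IsWeakDeriv j u w)
    (h' : IsWeakDeriv j u w') : w = w' :=
  field_ext fun k => (h k).trans (h' k).symm

theorem InV.isWeakDeriv {u : L2Field} (hu : InV u) (j : Fin 2) :
    IsWeakDeriv j u (partialDeriv j u) := by
  rw [partialDeriv, dif_pos (hu.2 j)]
  exact (hu.2 j).choose_spec

theorem IsWeakDeriv.sub {j : Fin 2} {u v u' v' : L2Field} (hu : IsWeakDeriv j u u')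
    (hv : IsWeakDeriv j v v') : IsWeakDeriv j (u - v) (u' - v') := fun k => by
  rw [coeff_sub, coeff_sub, hu k, hv k, smul_sub]

theorem InH.sub {u v : L2Field} (hu : InH u) (hv : InH v) : InH (u - v) := by
  refine ⟨by rw [coeff_sub, hu.1, hv.1, sub_zero], fun k => ?_⟩
  simp only [coeff_sub, Pi.sub_apply, mul_sub, Finset.sum_sub_distrib, hu.2 k, hv.2 k, sub_zero]

theorem InV.sub {u v : L2Field} (hu : InV u) (hv : InV v) : InV (u - v) :=
  ⟨hu.1.sub hv.1, fun j => ⟨_, (hu.isWeakDeriv j).sub (hv.isWeakDeriv j)⟩⟩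

theorem partialDeriv_sub {u v : L2Field} (hu : InV u) (hv : InV v) (j : Fin 2) :
    partialDeriv j (u - v) = partialDeriv j u - partialDeriv j v :=
  ((hu.sub hv).isWeakDeriv j).eq ((hu.isWeakDeriv j).sub (hv.isWeakDeriv j))

theorem InDA.isStokes {u : L2Field} (hu : InDA u) : IsStokes u (stokes u) := by
  rw [stokes, dif_pos hu.2]
  exact hu.2.choose_spec

theorem InDA.sub {u v : L2Field} (hu : InDA u) (hv : InDA v) : InDA (u - v) :=
  ⟨hu.1.sub hv.1, stokes u - stokes v, fun k => by
    rw [coeff_sub, coeff_sub, hu.isStokes k, hv.isStokes k, smul_sub]⟩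

theorem stokes_sub {u v : L2Field} (hu : InDA u) (hv : InDA v) :
    stokes (u - v) = stokes u - stokes v :=
  field_ext fun k => by
    rw [(hu.sub hv).isStokes k, coeff_sub, coeff_sub, hu.isStokes k, hv.isStokes k, smul_sub]

theorem normV_nonneg (u : L2Field) : 0 ≤ normV u := Real.sqrt_nonneg _

theorem normV_sq (u : L2Field) : normV u ^ 2 = ∑ j, ‖partialDeriv j u‖ ^ 2 :=
  Real.sq_sqrt (Finset.sum_nonneg fun _ _ => sq_nonneg _)

theorem hasSum_normV_sq {u : L2Field} (hu : InV u) :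
    HasSum (fun k => waveSq k * (4 * Real.pi ^ 2 * ∑ j, ‖coeff u k j‖ ^ 2)) (normV u ^ 2) := by
  rw [normV_sq]
  refine (hasSum_sum (s := Finset.univ) fun (j : Fin 2) _ =>
    hasSum_norm_sq (partialDeriv j u)).congr_fun fun k => ?_
  simp only [hu.isWeakDeriv _ k, Fin.sum_univ_two, Pi.smul_apply, smul_eq_mul, norm_mul,
    Complex.norm_I, one_mul, mul_pow, waveSq, Complex.norm_intCast, sq_abs]
  ring

theorem inner_stokes {u : L2Field} (hu : InV u) (hu' : InDA u) :
    inner ℝ (stokes u) u = normV u ^ 2 := by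
  refine (hasSum_inner _ _).unique ((hasSum_normV_sq hu).congr_fun fun k => ?_)
  have h : ∀ j, (conj (coeff (stokes u) k j) * coeff u k j).re =
      waveSq k * ‖coeff u k j‖ ^ 2 := fun j => by
    rw [hu'.isStokes k, Pi.smul_apply, smul_eq_mul, map_mul, Complex.conj_ofReal, mul_assoc,
      Complex.re_ofReal_mul, ← Complex.normSq_eq_conj_mul_self, Complex.ofReal_re,
      Complex.normSq_eq_norm_sq]
  simp only [h, ← Finset.mul_sum]
  ring

theorem one_le_waveSq {k : Fin 2 → ℤ} (hk : k ≠ 0) : 1 ≤ waveSq k := by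
  have h : (1 : ℤ) ≤ k 0 ^ 2 + k 1 ^ 2 := by
    by_contra h
    have h0 : k 0 ^ 2 = 0 := by nlinarith [sq_nonneg (k 0), sq_nonneg (k 1)]
    have h1 : k 1 ^ 2 = 0 := by nlinarith [sq_nonneg (k 0), sq_nonneg (k 1)]
    refine hk (funext fun j => ?_)
    fin_cases j
    · simpa using h0
    · simpa using h1
  unfold waveSq
  exact_mod_cast h

/-- The Poincaré inequality for the modes `|k| > N`. -/
theorem poincare_high {u : L2Field} (hu : InV u) {N : ℝ} (hN : 0 ≤ N) :
    max N 1 ^ 2 * (‖u‖ ^ 2 - ‖proj N u‖ ^ 2) ≤ normV u ^ 2 := by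
  refine hasSum_le (fun k => ?_) (((hasSum_norm_sq u).sub (hasSum_norm_sq (proj N u))).mul_left
    (max N 1 ^ 2)) (hasSum_normV_sq hu)
  set a := 4 * Real.pi ^ 2 * ∑ j, ‖coeff u k j‖ ^ 2 with ha
  have ha0 : 0 ≤ a := by positivity
  rw [coeff_proj]
  split_ifs with h
  · rw [← ha, sub_self, mul_zero]
    exact mul_nonneg (waveSq_nonneg k) ha0
  · simp only [Pi.zero_apply, norm_zero, ne_eq, OfNat.ofNat_ne_zero, not_false_eq_true, zero_pow,
      Finset.sum_const_zero, mul_zero, sub_zero]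
    -- For `N < 1` the remaining modes still satisfy `|k| ≥ 1`, since the mean vanishes.
    by_cases hk : k = 0
    · have : a = 0 := by rw [ha, hk, hu.1.1]; simp
      rw [this]; simp
    · refine mul_le_mul_of_nonneg_right ?_ ha0
      rw [mem_lowModes, not_le] at h
      rcases max_cases N 1 with h1 | h1 <;> rw [h1.1]
      · exact ((Real.lt_sqrt hN).1 h).le
      · simpa using one_le_waveSq hk

theorem norm_le_normV {u : L2Field} (hu : InV u) : ‖u‖ ≤ normV u := by
  have h : HasSum (fun k => 4 * Real.pi ^ 2 * ∑ j, ‖coeff u k j‖ ^ 2) (‖u‖ ^ 2) := hasSum_norm_sq u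
  refine le_of_sq_le_sq (hasSum_le (fun k => ?_) h (hasSum_normV_sq hu)) (normV_nonneg u)
  by_cases hk : k = 0
  · rw [hk, hu.1.1]; simp
  · exact le_mul_of_one_le_left (by positivity) (one_le_waveSq hk)

/-! ### Pointwise limits of truncations, and boundedness of fields in `D(A)` -/

theorem exists_seq_lowPart_tendsto (u : L2Field) : ∃ ns : ℕ → ℕ, StrictMono ns ∧
    ∀ᵐ x, Tendsto (fun i => lowPart (ns i) u x) atTop (𝓝 (u x)) := by
  obtain ⟨ns, hns, h⟩ := (tendstoInMeasure_of_tendsto_Lp (tendsto_proj u)).exists_seq_tendsto_ae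
  refine ⟨ns, hns, ?_⟩
  have h2 : ∀ᵐ x, ∀ i, proj (ns i) u x = lowPart (ns i) u x :=
    ae_all_iff.2 fun i => ContinuousMap.coeFn_toLp (𝕜 := ℝ) volume (lowPart (ns i) u)
  filter_upwards [h, h2] with x hx hx2
  simpa only [hx2] using hx

theorem norm_sq_le_waveSq (k : Fin 2 → ℤ) : ‖k‖ ^ 2 ≤ waveSq k := by
  have h : ‖k‖ ≤ √(waveSq k) := by
    refine (pi_norm_le_iff_of_nonneg (Real.sqrt_nonneg _)).2 fun j => ?_
    rw [Int.norm_eq_abs]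
    refine Real.abs_le_sqrt ?_
    fin_cases j <;> simp only [waveSq, Fin.zero_eta, Fin.mk_one] <;>
      nlinarith [sq_nonneg (k 0 : ℝ), sq_nonneg (k 1 : ℝ)]
  calc ‖k‖ ^ 2 ≤ √(waveSq k) ^ 2 := by gcongr
    _ = waveSq k := Real.sq_sqrt (waveSq_nonneg k)

/-- In dimension two `|k|⁻²` is square summable over `k ≠ 0`, and so are the coefficients of `A u`.
The product of the two is therefore summable. The norm `‖k‖` here is the sup norm, which is at most
`|k|`. -/
theorem InDA.summable_coeff {u : L2Field} (hu : InDA u) (j : Fin 2) :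
    Summable fun k => ‖coeff u k j‖ := by
  have h1 := EisensteinSeries.summable_one_div_norm_rpow (k := 4) (by norm_num)
  have h2 := (hasSum_norm_sq (stokes u)).summable
  have h3 : Summable fun k => ‖coeff (stokes u) k j‖ ^ 2 := by
    refine Summable.of_nonneg_of_le (fun k => sq_nonneg _) (fun k => ?_) h2
    have h4 : ‖coeff (stokes u) k j‖ ^ 2 ≤ ∑ i, ‖coeff (stokes u) k i‖ ^ 2 :=
      Finset.single_le_sum (f := fun i => ‖coeff (stokes u) k i‖ ^ 2)
        (fun i _ => sq_nonneg _) (Finset.mem_univ j)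
    have h5 : 1 ≤ 4 * Real.pi ^ 2 := by nlinarith [Real.pi_gt_three]
    exact h4.trans (le_mul_of_one_le_left (Finset.sum_nonneg fun i _ => sq_nonneg _) h5)
  refine Summable.of_nonneg_of_le (fun k => norm_nonneg _) (fun k => ?_) (h1.add h3)
  by_cases hk : k = 0
  · rw [hk, hu.1.1, Pi.zero_apply, norm_zero]
    positivity
  · have hn : 0 < ‖k‖ := norm_pos_iff.2 hk
    have h6 : ‖k‖ ^ 2 * ‖coeff u k j‖ ≤ ‖coeff (stokes u) k j‖ := by
      rw [hu.isStokes k, Pi.smul_apply, smul_eq_mul, norm_mul, Complex.norm_of_nonneg (waveSq_nonneg k)]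
      exact mul_le_mul_of_nonneg_right (norm_sq_le_waveSq k) (norm_nonneg _)
    have h7 : ‖k‖ ^ (-(4 : ℝ)) = ((‖k‖ ^ 2)⁻¹) ^ 2 := by
      rw [Real.rpow_neg hn.le, show (4 : ℝ) = ((4 : ℕ) : ℝ) by norm_num, Real.rpow_natCast,
        inv_pow, ← pow_mul]
    rw [h7]
    have h8 : ‖coeff u k j‖ ≤ (‖k‖ ^ 2)⁻¹ * ‖coeff (stokes u) k j‖ := by
      rw [inv_mul_eq_div, le_div_iff₀ (by positivity)]
      linarith
    nlinarith [sq_nonneg ((‖k‖ ^ 2)⁻¹ - ‖coeff (stokes u) k j‖),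
      sq_nonneg ((‖k‖ ^ 2)⁻¹), sq_nonneg (‖coeff (stokes u) k j‖)]

/-- Fields in `D(A)` are bounded. -/
theorem InDA.exists_bound {u : L2Field} (hu : InDA u) : ∃ K, ∀ᵐ x, ‖u x‖ ≤ K := by
  obtain ⟨ns, -, h⟩ := exists_seq_lowPart_tendsto u
  refine ⟨∑ j, ∑' k, ‖coeff u k j‖, ?_⟩
  filter_upwards [h] with x hx
  refine le_of_tendsto hx.norm (.of_forall fun i => ?_)
  have h1 : ∀ j, ‖lowPart (ns i) u x j‖ ≤ ∑' k, ‖coeff u k j‖ := by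
    intro j
    rw [← Complex.norm_real, ofReal_lowPart]
    refine (norm_sum_le _ _).trans ?_
    simp only [norm_mul, norm_character, mul_one]
    exact (hu.summable_coeff j).sum_le_tsum _ fun _ _ => norm_nonneg _
  have h2 : ‖lowPart (ns i) u x‖ ≤ ∑ j, ‖lowPart (ns i) u x j‖ := by
    refine le_of_sq_le_sq ?_ (Finset.sum_nonneg fun _ _ => norm_nonneg _)
    rw [EuclideanSpace.norm_sq_eq, Fin.sum_univ_two, Fin.sum_univ_two]
    nlinarith [norm_nonneg (lowPart (ns i) u x 0), norm_nonneg (lowPart (ns i) u x 1)]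
  exact h2.trans (Finset.sum_le_sum fun j _ => h1 j)

/-! ### The trilinear form -/

/-- The weak form of the equation, against divergence-free test fields. -/
theorem inner_weak_form {v' a f F φ : L2Field} {ν : ℝ} (hφ : InH φ)
    (h : ∀ k, coeff v' k + (ν : ℂ) • coeff a k + leray (coeff f) k = coeff F k) :
    inner ℝ v' φ + ν * inner ℝ a φ + inner ℝ f φ = (inner ℝ F φ : ℝ) := by
  have hz : inner ℝ (v' + ν • a + f - F) φ = (0 : ℝ) := by
    refine (hasSum_inner _ _).unique (hasSum_zero.congr_fun fun k => ?_)
    have h1 : ∀ j, coeff (v' + ν • a + f - F : L2Field) k j = coeff f k j - leray (coeff f) k j := by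
      intro j
      have := congrFun (h k) j
      rw [coeff_sub, coeff_add, coeff_add, coeff_smul]
      simp only [Pi.add_apply, Pi.sub_apply] at this ⊢
      rw [← this]
      ring
    rw [← Complex.re_sum]
    simp only [h1]
    by_cases hk : k = 0
    · rw [hk, hφ.1]; simp
    -- What the Leray projection removes is parallel to `k`, hence orthogonal to the divergence-free
    -- `φ` in each mode.
    · have h2 : ∀ j, conj (coeff f k j - leray (coeff f) k j) * coeff φ k j =
          conj ((∑ i, (k i : ℂ) * coeff f k i) / (waveSq k : ℂ)) * ((k j : ℂ) * coeff φ k j) := by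
        intro j
        rw [leray, if_neg hk, sub_sub_cancel, map_mul, map_intCast]
        ring
      simp only [h2, ← Finset.mul_sum, hφ.2 k, mul_zero, Complex.zero_re]
  simpa only [inner_sub_left, inner_add_left, real_inner_smul_left, sub_eq_zero] using hz

/-- Multiplication of square integrable fields by the bounded `j`-th component of `u`. -/
def mulComponent {u : L2Field} (hu : InDA u) (j : Fin 2) : L2Field →L[ℝ] L2Field :=
  (ContinuousLinearMap.lsmul ℝ ℝ : ℝ →L[ℝ] Plane →L[ℝ] Plane).holderL volume ∞ 2 2
    ((memLp_top_of_bound (memLp_component (Lp.memLp u) j).aestronglyMeasurable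
      hu.exists_bound.choose (hu.exists_bound.choose_spec.mono fun x hx =>
        (PiLp.norm_apply_le (u x) j).trans hx)).toLp _)

theorem coeFn_mulComponent {u : L2Field} (hu : InDA u) (j : Fin 2) (a : L2Field) :
    mulComponent hu j a =ᵐ[volume] fun x => u x j • a x := by
  refine (ContinuousLinearMap.coeFn_holder (r := 2) _ _ _).trans ?_
  filter_upwards [(memLp_top_of_bound (memLp_component (Lp.memLp u) j).aestronglyMeasurable
      hu.exists_bound.choose (hu.exists_bound.choose_spec.mono fun x hx =>
        (PiLp.norm_apply_le (u x) j).trans hx)).coeFn_toLp] with x hx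
  rw [hx]; rfl

theorem sum_mulComponent {u : L2Field} (hu : InDA u) (v : L2Field) :
    (∑ j, mulComponent hu j (partialDeriv j v) : L2Field) =ᵐ[volume] advection u v := by
  rw [Fin.sum_univ_two]
  filter_upwards [Lp.coeFn_add (mulComponent hu 0 (partialDeriv 0 v))
    (mulComponent hu 1 (partialDeriv 1 v)), coeFn_mulComponent hu 0 (partialDeriv 0 v),
    coeFn_mulComponent hu 1 (partialDeriv 1 v)] with x h h0 h1
  rw [h, Pi.add_apply, h0, h1, advection, Fin.sum_univ_two]

/-- `(u · ∇) v` as a square integrable field, for `u ∈ D(A)`. -/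
def advectionLp {u : L2Field} (hu : InDA u) (v : L2Field) : L2Field :=
  ∑ j, mulComponent hu j (partialDeriv j v)

theorem coeff_advection {u : L2Field} (hu : InDA u) (v : L2Field) :
    coeff (advection u v) = coeff (advectionLp hu v) :=
  coeff_congr (sum_mulComponent hu v).symm

/-- In this splitting the last term vanishes when tested against `u - v`, so the gradient of `u`
alone enters the estimate of the difference. -/
theorem advectionLp_sub {u v : L2Field} (hu : InDA u) (hv : InDA v) (hu' : InV u) (hv' : InV v) :
    advectionLp hu u - advectionLp hv v =
      advectionLp (hu.sub hv) u + advectionLp hv (u - v) := by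
  have h1 : ∀ j, mulComponent (hu.sub hv) j (partialDeriv j u) =
      mulComponent hu j (partialDeriv j u) - mulComponent hv j (partialDeriv j u) := by
    intro j
    refine Lp.ext ?_
    filter_upwards [coeFn_mulComponent (hu.sub hv) j (partialDeriv j u),
      coeFn_mulComponent hu j (partialDeriv j u), coeFn_mulComponent hv j (partialDeriv j u),
      Lp.coeFn_sub (mulComponent hu j (partialDeriv j u)) (mulComponent hv j (partialDeriv j u)),
      Lp.coeFn_sub u v] with x h1 h2 h3 h4 h5
    rw [h1, h4, Pi.sub_apply, h2, h3, h5, Pi.sub_apply, PiLp.sub_apply, sub_smul]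
  simp only [advectionLp, h1, partialDeriv_sub hu' hv', map_sub, Finset.sum_sub_distrib]
  abel

theorem integral_component_mul_trig (u : L2Field) (j : Fin 2) (s : Finset (Fin 2 → ℤ))
    (a b : (Fin 2 → ℤ) → ℂ) :
    ∫ x, (u x j : ℂ) * ((∑ k ∈ s, a k * character k x) * ∑ l ∈ s, b l * character l x) =
      ∑ k ∈ s, ∑ l ∈ s, a k * b l * (4 * Real.pi ^ 2 * coeff u (-(k + l)) j) := by
  have hint : ∀ k, Integrable (fun x => (u x j : ℂ) * character k x) volume :=
    integrable_mul_character (integrable_component (integrable_field u) j)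
  have h : ∀ x, (u x j : ℂ) * ((∑ k ∈ s, a k * character k x) * ∑ l ∈ s, b l * character l x) =
      ∑ k ∈ s, ∑ l ∈ s, a k * b l * ((u x j : ℂ) * character (k + l) x) := by
    intro x
    rw [Finset.sum_mul_sum, Finset.mul_sum]
    refine Finset.sum_congr rfl fun k _ => ?_
    rw [Finset.mul_sum]
    refine Finset.sum_congr rfl fun l _ => ?_
    rw [character_add]; ring
  simp only [h]
  rw [integral_finsetSum _ fun k _ => integrable_finsetSum _ fun l _ => (hint _).const_mul _]
  refine Finset.sum_congr rfl fun k _ => ?_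
  rw [integral_finsetSum _ fun l _ => (hint _).const_mul _]
  refine Finset.sum_congr rfl fun l _ => ?_
  rw [integral_const_mul]
  have hpi : (Real.pi : ℂ) ≠ 0 := by exact_mod_cast Real.pi_ne_zero
  simp only [coeff, neg_neg]
  push_cast
  field_simp

/-- With `v` truncated this is a finite double sum over modes `k, l` of `v`, with weight `k ·
û_{-(k+l)}`. Since `u` is divergence-free, `(k + l) · û_{-(k+l)} = 0`, so exchanging `k` and `l`
changes the sign of the sum, which is therefore zero. -/
theorem sum_inner_mulComponent_proj {u v : L2Field} (hu : InDA u) (hv : InV v) (N : ℝ) :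
    ∑ j, inner ℝ (mulComponent hu j (proj N (partialDeriv j v))) (proj N v) = (0 : ℝ) := by
  set c := fun (k : Fin 2 → ℤ) i => coeff v k i with hc
  have h1 : ∀ j, ((inner ℝ (mulComponent hu j (proj N (partialDeriv j v))) (proj N v) : ℝ) : ℂ) =
      ∑ i, ∑ k ∈ lowModes N, ∑ l ∈ lowModes N, (Complex.I * k j * c k i) * c l i *
        (4 * Real.pi ^ 2 * coeff u (-(k + l)) j) := by
    intro j
    rw [L2.inner_def]
    have h2 : ∫ x, inner ℝ (mulComponent hu j (proj N (partialDeriv j v)) x) (proj N v x) =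
        ∫ x, ∑ i, u x j * (lowPart N (partialDeriv j v) x i * lowPart N v x i) := by
      refine integral_congr_ae ?_
      filter_upwards [coeFn_mulComponent hu j (proj N (partialDeriv j v)),
        ContinuousMap.coeFn_toLp (𝕜 := ℝ) (p := 2) volume (lowPart N (partialDeriv j v)),
        ContinuousMap.coeFn_toLp (𝕜 := ℝ) (p := 2) volume (lowPart N v)] with x h1 h2 h3
      rw [h1, proj, proj, h2, h3, plane_inner]
      refine Finset.sum_congr rfl fun i _ => ?_
      rw [PiLp.smul_apply, smul_eq_mul]
      ring
    have h3 : ∀ i, Integrable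
        (fun x => u x j * (lowPart N (partialDeriv j v) x i * lowPart N v x i)) volume := by
      intro i
      have hcont : Continuous fun x => lowPart N (partialDeriv j v) x i * lowPart N v x i := by
        fun_prop
      obtain ⟨K, hK⟩ := isCompact_univ.exists_bound_of_continuousOn hcont.continuousOn
      exact (integrable_component (integrable_field u) j).mul_bdd (c := K)
        hcont.aestronglyMeasurable (.of_forall fun x => hK x (mem_univ x))
    rw [h2, integral_finsetSum _ fun i _ => h3 i]
    push_cast
    refine Finset.sum_congr rfl fun i _ => ?_
    rw [← integral_complex_ofReal, ← integral_component_mul_trig]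
    refine integral_congr_ae (.of_forall fun x => ?_)
    simp only [Complex.ofReal_mul, ofReal_lowPart, hv.isWeakDeriv j _, Pi.smul_apply, smul_eq_mul, hc]
  have h4 : (∑ j, ((inner ℝ (mulComponent hu j (proj N (partialDeriv j v))) (proj N v) : ℝ) : ℂ)) =
      ∑ i, ∑ k ∈ lowModes N, ∑ l ∈ lowModes N, c k i * c l i * ∑ j, (4 * Complex.I * Real.pi ^ 2 *
        ((k j : ℂ) * coeff u (-(k + l)) j)) := by
    simp only [h1]
    rw [Finset.sum_comm]
    refine Finset.sum_congr rfl fun i _ => ?_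
    rw [Finset.sum_comm]
    refine Finset.sum_congr rfl fun k _ => ?_
    rw [Finset.sum_comm]
    refine Finset.sum_congr rfl fun l _ => ?_
    rw [Finset.mul_sum]
    refine Finset.sum_congr rfl fun j _ => ?_
    ring
  have h5 : ∀ k l : Fin 2 → ℤ, (∑ j, 4 * Complex.I * Real.pi ^ 2 * ((k j : ℂ) * coeff u (-(k + l)) j)) =
      - ∑ j, 4 * Complex.I * Real.pi ^ 2 * ((l j : ℂ) * coeff u (-(l + k)) j) := by
    intro k l
    have h6 := hu.1.2 (-(k + l))
    rw [add_comm l k, eq_neg_iff_add_eq_zero, ← Finset.mul_sum, ← Finset.mul_sum, ← mul_add,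
      ← Finset.sum_add_distrib]
    refine mul_eq_zero_of_right _ ?_
    rw [← neg_eq_zero, ← h6, ← Finset.sum_neg_distrib]
    refine Finset.sum_congr rfl fun j _ => ?_
    simp only [Pi.neg_apply, Pi.add_apply]
    push_cast; ring
  have h7 : (∑ j, ((inner ℝ (mulComponent hu j (proj N (partialDeriv j v))) (proj N v) : ℝ) : ℂ)) =
      - ∑ j, ((inner ℝ (mulComponent hu j (proj N (partialDeriv j v))) (proj N v) : ℝ) : ℂ) := by
    conv_lhs => rw [h4]
    rw [h4, ← Finset.sum_neg_distrib]
    refine Finset.sum_congr rfl fun i _ => ?_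
    refine Finset.sum_comm.trans ?_
    rw [← Finset.sum_neg_distrib]
    refine Finset.sum_congr rfl fun k _ => ?_
    rw [← Finset.sum_neg_distrib]
    refine Finset.sum_congr rfl fun l _ => ?_
    rw [h5 l k]
    ring
  exact_mod_cast self_eq_neg.1 h7

/-- The orthogonality `∫ ((u · ∇) v) · v = 0`. -/
theorem inner_advectionLp_self {u v : L2Field} (hu : InDA u) (hv : InV v) :
    inner ℝ (advectionLp hu v) v = (0 : ℝ) := by
  have h1 : Tendsto (fun n : ℕ =>
      ∑ j, inner ℝ (mulComponent hu j (proj n (partialDeriv j v))) (proj n v)) atTop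
      (𝓝 (∑ j, (inner ℝ (mulComponent hu j (partialDeriv j v)) v : ℝ))) :=
    tendsto_finsetSum _ fun j _ => (((mulComponent hu j).continuous.tendsto _).comp
      (tendsto_proj (partialDeriv j v))).inner (tendsto_proj v)
  simp only [sum_inner_mulComponent_proj hu hv] at h1
  rw [advectionLp, sum_inner]
  exact (tendsto_nhds_unique h1 tendsto_const_nhds)

theorem norm_sum_smul_le (a : Plane) (b : Fin 2 → Plane) :
    ‖∑ j, a j • b j‖ ≤ ‖a‖ * √(∑ j, ‖b j‖ ^ 2) := by
  refine (norm_sum_le _ _).trans ?_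
  have h := Real.sum_mul_le_sqrt_mul_sqrt Finset.univ (fun j => ‖a j‖) (fun j => ‖b j‖)
  rw [← EuclideanSpace.norm_eq] at h
  simpa only [norm_smul] using h

/-- The estimate of the trilinear term by Ladyzhenskaya's inequality. -/
theorem abs_inner_advectionLp_le {C : ℝ} (hC : IsLadyzhenskayaConstant C) {w v : L2Field}
    (hw : InDA w) (hw' : InV w) :
    |inner ℝ (advectionLp hw v) w| ≤ C * normV w * ‖w‖ * normV v := by
  have hL := hC.2 w hw'
  have hR : 0 ≤ C * normV w * ‖w‖ :=
    mul_nonneg (mul_nonneg hC.1.le (normV_nonneg w)) (norm_nonneg w)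
  -- Ladyzhenskaya's inequality bounds `|w|²` in `L²`. Cauchy–Schwarz applied to `∫ |w|² |∇v|` then
  -- suffices.
  have hsq : eLpNorm (fun x => ‖w x‖ ^ (2 : ℝ)) 2 volume = eLpNorm w 4 volume ^ 2 := by
    rw [eLpNorm_norm_rpow _ (by norm_num)]
    norm_num
  have hwL : MemLp (fun x => ‖w x‖ ^ (2 : ℝ)) 2 volume := by
    refine ⟨((Lp.aestronglyMeasurable w).norm.aemeasurable.pow_const _).aestronglyMeasurable, ?_⟩
    rw [hsq]
    exact hL.trans_lt ENNReal.ofReal_lt_top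
  have hD : ∀ j, MemLp (fun x => ‖partialDeriv j v x‖) 2 volume := fun j => (Lp.memLp _).norm
  have hGm : AEStronglyMeasurable (fun x => √(∑ j, ‖partialDeriv j v x‖ ^ 2)) volume := by
    refine Real.continuous_sqrt.comp_aestronglyMeasurable ?_
    simp only [Fin.sum_univ_two]
    exact ((hD 0).aestronglyMeasurable.pow 2).add ((hD 1).aestronglyMeasurable.pow 2)
  have hGsq : ∀ x, √(∑ j, ‖partialDeriv j v x‖ ^ 2) ^ 2 = ∑ j, ‖partialDeriv j v x‖ ^ 2 :=
    fun x => Real.sq_sqrt (Finset.sum_nonneg fun _ _ => sq_nonneg _)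
  have hG : MemLp (fun x => √(∑ j, ‖partialDeriv j v x‖ ^ 2)) 2 volume := by
    rw [memLp_two_iff_integrable_sq hGm]
    simp only [hGsq]
    exact integrable_finsetSum _ fun j _ => (hD j).integrable_sq
  have h1 : |inner ℝ (advectionLp hw v) w| ≤
      ∫ x, ‖w x‖ ^ (2 : ℝ) * √(∑ j, ‖partialDeriv j v x‖ ^ 2) := by
    rw [L2.inner_def, ← Real.norm_eq_abs]
    refine (norm_integral_le_integral_norm _).trans ?_
    refine integral_mono_of_nonneg (.of_forall fun x => norm_nonneg _) (hwL.integrable_mul hG) ?_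
    filter_upwards [sum_mulComponent hw v] with x hx
    rw [advectionLp, hx]
    refine (norm_inner_le_norm _ _).trans ?_
    have := mul_le_mul_of_nonneg_right
      (norm_sum_smul_le (w x) fun j => partialDeriv j v x) (norm_nonneg (w x))
    refine this.trans (le_of_eq ?_)
    rw [Real.rpow_two]
    ring
  have h2 : ∫ x, ‖w x‖ ^ (2 : ℝ) * √(∑ j, ‖partialDeriv j v x‖ ^ 2) ≤
      ‖hwL.toLp _‖ * ‖hG.toLp _‖ := by
    refine le_trans (le_of_eq ?_) (real_inner_le_norm (hwL.toLp _) (hG.toLp _))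
    rw [L2.inner_def]
    refine integral_congr_ae ?_
    filter_upwards [hwL.coeFn_toLp, hG.coeFn_toLp] with x h1 h2
    rw [h1, h2, RCLike.inner_apply, conj_trivial, mul_comm]
  have h3 : ‖hwL.toLp _‖ ≤ C * normV w * ‖w‖ := by
    rw [Lp.norm_toLp, hsq]
    exact ENNReal.toReal_le_of_le_ofReal hR hL
  have h4 : ‖hG.toLp _‖ = normV v := by
    have h5 : ‖hG.toLp _‖ ^ 2 = normV v ^ 2 := by
      rw [normV_sq, ← real_inner_self_eq_norm_sq, L2.inner_def]
      have h6 : ∀ j, ‖partialDeriv j v‖ ^ 2 = ∫ x, ‖partialDeriv j v x‖ ^ 2 := fun j => by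
        rw [← real_inner_self_eq_norm_sq, L2.inner_def]
        simp only [real_inner_self_eq_norm_sq]
      simp only [h6]
      rw [← integral_finsetSum _ fun j _ => (hD j).integrable_sq]
      refine integral_congr_ae ?_
      filter_upwards [hG.coeFn_toLp] with x h2
      rw [real_inner_self_eq_norm_sq, h2, Real.norm_eq_abs, sq_abs, hGsq]
    exact (pow_left_inj₀ (norm_nonneg _) (normV_nonneg v) two_ne_zero).1 h5
  rw [h4] at h2
  exact h1.trans (h2.trans (mul_le_mul_of_nonneg_right h3 (normV_nonneg v)))

/-! ### Ladyzhenskaya's inequality -/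

/-- The difference `f a - f b` is at most the total variation over one period; averaging over `b`
gives the claim. -/
theorem le_average_add_integral_abs_deriv {f f' : AddCircle (2 * Real.pi) → ℝ} (hf : Continuous f)
    (hf' : Continuous f') (hd : ∀ s : ℝ, HasDerivAt (fun s : ℝ => f s) (f' s) s)
    (a : AddCircle (2 * Real.pi)) :
    f a ≤ (2 * Real.pi)⁻¹ * (∫ b, f b) + ∫ b, |f' b| := by
  have h1 : ∀ b, f a - f b ≤ ∫ b, |f' b| := by
    intro b
    obtain ⟨α, rfl⟩ := QuotientAddGroup.mk_surjective a
    -- The lift of `b` is taken in the period ending at `α`, so the path from `β` to `α` stays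
    -- within one period.
    set β := AddCircle.equivIoc (2 * Real.pi) (α - 2 * Real.pi) b with hβ
    have hb : ((β : ℝ) : AddCircle (2 * Real.pi)) = b :=
      (AddCircle.equivIoc (2 * Real.pi) (α - 2 * Real.pi)).symm_apply_apply b
    have hβ2 : (β : ℝ) ∈ Ioc (α - 2 * Real.pi) α := by
      have h := β.2
      exact ⟨h.1, h.2.trans_eq (sub_add_cancel _ _)⟩
    have hc' : Continuous fun s : ℝ => f' s := hf'.comp (AddCircle.continuous_mk' _)
    have h2 := intervalIntegral.integral_eq_sub_of_hasDerivAt (a := β) (b := α) (fun s _ => hd s)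
      (hc'.intervalIntegrable _ _)
    rw [hb] at h2
    have h3 := AddCircle.intervalIntegral_preimage (2 * Real.pi) (α - 2 * Real.pi) fun b => |f' b|
    rw [sub_add_cancel] at h3
    rw [← h3]
    refine h2.symm.le.trans ?_
    have h4 : ∫ s in (β : ℝ)..α, f' s ≤ ∫ s in (β : ℝ)..α, |f' s| :=
      intervalIntegral.integral_mono_on hβ2.2 (hc'.intervalIntegrable _ _)
        (hc'.abs.intervalIntegrable _ _) fun s _ => le_abs_self _
    refine h4.trans ?_
    exact intervalIntegral.integral_mono_interval hβ2.1.le hβ2.2 le_rfl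
      (.of_forall fun s => abs_nonneg _) (hc'.abs.intervalIntegrable _ _)
  have hfi : Integrable f volume :=
    hf.integrable_of_hasCompactSupport (HasCompactSupport.of_compactSpace _)
  have h2 := integral_mono ((integrable_const (f a)).sub hfi) (integrable_const _) h1
  simp only [Pi.sub_apply] at h2
  rw [integral_sub (integrable_const _) hfi, integral_const, integral_const, measureReal_def,
    AddCircle.measure_univ, ENNReal.toReal_ofReal Real.two_pi_pos.le, smul_eq_mul, smul_eq_mul] at h2
  have hpi := Real.two_pi_pos
  rw [← sub_le_iff_le_add, le_inv_mul_iff₀ hpi]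
  linarith

theorem integral_torus {g : Torus → ℝ} (hg : Continuous g) :
    ∫ x, g x = ∫ a : AddCircle (2 * Real.pi), ∫ b : AddCircle (2 * Real.pi), g ![a, b] := by
  have hc : Continuous fun z : AddCircle (2 * Real.pi) × AddCircle (2 * Real.pi) => g ![z.1, z.2] := by
    refine hg.comp (continuous_pi fun i => ?_)
    fin_cases i
    · exact continuous_fst
    · exact continuous_snd
  rw [← (volume_preserving_finTwoArrow (AddCircle (2 * Real.pi))).symm.integral_comp']
  rw [Measure.volume_eq_prod, integral_prod]
  · rfl
  · exact hc.integrable_of_hasCompactSupport (HasCompactSupport.of_compactSpace _)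

/-- A function on the torus bounded by functions of one variable each. -/
theorem integral_sq_le_mul {f g₀ g₁ : Torus → ℝ} (hf : Continuous f) (hg₀ : Continuous g₀)
    (hg₁ : Continuous g₁) (hf0 : ∀ x, 0 ≤ f x)
    (h₀ : ∀ a b, f ![a, b] ≤ ∫ c : AddCircle (2 * Real.pi), g₀ ![c, b])
    (h₁ : ∀ a b, f ![a, b] ≤ ∫ c : AddCircle (2 * Real.pi), g₁ ![a, c]) :
    ∫ x, f x ^ 2 ≤ (∫ x, g₀ x) * ∫ x, g₁ x := by
  have hvec : Continuous fun z : AddCircle (2 * Real.pi) × AddCircle (2 * Real.pi) =>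
      (![z.1, z.2] : Torus) := by
    refine continuous_pi fun i => ?_
    fin_cases i
    · exact continuous_fst
    · exact continuous_snd
  have hcomp : ∀ {g : Torus → ℝ}, Continuous g → Integrable
      (fun z : AddCircle (2 * Real.pi) × AddCircle (2 * Real.pi) => g ![z.1, z.2])
      (volume.prod volume) := fun hg =>
    (hg.comp hvec).integrable_of_hasCompactSupport (HasCompactSupport.of_compactSpace _)
  have hI₀ : Integrable (fun b : AddCircle (2 * Real.pi) =>
      ∫ c : AddCircle (2 * Real.pi), g₀ ![c, b]) volume := (hcomp hg₀).integral_prod_right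
  have hI₁ : Integrable (fun a : AddCircle (2 * Real.pi) =>
      ∫ c : AddCircle (2 * Real.pi), g₁ ![a, c]) volume := (hcomp hg₁).integral_prod_left
  have hswap : ∫ x, g₀ x = ∫ b : AddCircle (2 * Real.pi), ∫ c : AddCircle (2 * Real.pi), g₀ ![c, b] := by
    rw [integral_torus hg₀]
    exact integral_integral_swap (hcomp hg₀)
  have hf2 : Continuous fun x => f x ^ 2 := hf.pow 2
  rw [hswap, integral_torus hg₁, mul_comm (∫ _, _), ← integral_prod_mul, integral_torus hf2,
    integral_integral (f := fun a b => f ![a, b] ^ 2) (hcomp hf2)]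
  -- One factor `f` is bounded by a function of the first variable and the other by a function of
  -- the second, so the integral of the product factorizes.
  refine integral_mono (hcomp hf2) (hI₁.mul_prod hI₀) fun z => ?_
  simp only
  rw [sq]
  exact mul_le_mul (h₁ _ _) (h₀ _ _) (hf0 _) ((hf0 _).trans (h₁ z.1 z.2))

/-! ### Line bounds for trigonometric polynomials -/

theorem hasDerivAt_fourier_two_pi (n : ℤ) (s : ℝ) :
    HasDerivAt (fun s : ℝ => (fourier n (s : AddCircle (2 * Real.pi)) : ℂ))
      (Complex.I * n * fourier n (s : AddCircle (2 * Real.pi))) s := by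
  have h := hasDerivAt_fourier (2 * Real.pi) n s
  have hpi : (Real.pi : ℂ) ≠ 0 := by exact_mod_cast Real.pi_ne_zero
  convert h using 1
  push_cast
  field_simp

theorem hasDerivAt_lowPart {u : L2Field} {i : Fin 2} (N : ℝ) {w : L2Field} (hw : IsWeakDeriv i u w)
    {γ : ℝ → Torus} {s : ℝ}
    (hγ : ∀ k, HasDerivAt (fun s => character k (γ s)) (Complex.I * k i * character k (γ s)) s)
    (j : Fin 2) : HasDerivAt (fun s => lowPart N u (γ s) j) (lowPart N w (γ s) j) s := by
  have h1 : HasDerivAt (fun s => ∑ k ∈ lowModes N, coeff u k j * character k (γ s))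
      (∑ k ∈ lowModes N, coeff w k j * character k (γ s)) s := by
    refine HasDerivAt.fun_sum fun k _ => ?_
    rw [hw k, Pi.smul_apply, smul_eq_mul]
    convert! (hγ k).const_mul (coeff u k j) using 1
    ring
  exact Complex.reCLM.hasFDerivAt.comp_hasDerivAt s h1

theorem hasDerivAt_norm_lowPart_sq {u : L2Field} {i : Fin 2} (N : ℝ) {w : L2Field}
    (hw : IsWeakDeriv i u w) {γ : ℝ → Torus} {s : ℝ}
    (hγ : ∀ k, HasDerivAt (fun s => character k (γ s)) (Complex.I * k i * character k (γ s)) s) :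
    HasDerivAt (fun s => ‖lowPart N u (γ s)‖ ^ 2)
      (2 * inner ℝ (lowPart N u (γ s)) (lowPart N w (γ s))) s := by
  simp only [EuclideanSpace.real_norm_sq_eq, plane_inner, Finset.mul_sum]
  refine HasDerivAt.fun_sum fun j _ => ?_
  convert! (hasDerivAt_lowPart N hw hγ j).pow 2 using 1
  simp; ring

/-- The density whose line integrals bound `|P_N u|²`. -/
def lineDensity (N : ℝ) (u w : L2Field) (x : Torus) : ℝ :=
  (2 * Real.pi)⁻¹ * ‖lowPart N u x‖ ^ 2 + |2 * inner ℝ (lowPart N u x) (lowPart N w x)|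

theorem continuous_lineDensity (N : ℝ) (u w : L2Field) : Continuous (lineDensity N u w) := by
  unfold lineDensity; fun_prop

theorem integral_inner_lowPart (N : ℝ) (u w : L2Field) :
    ∫ x, ‖lowPart N u x‖ * ‖lowPart N w x‖ ≤ ‖u‖ * ‖w‖ := by
  have h : ∀ u : L2Field, ‖(Lp.memLp (proj N u)).norm.toLp _‖ ≤ ‖u‖ := fun u => by
    rw [Lp.norm_toLp, eLpNorm_norm, ← Lp.norm_def]
    exact norm_proj_le N u
  refine le_trans (le_of_eq ?_) ((real_inner_le_norm _ _).trans
    (mul_le_mul (h u) (h w) (norm_nonneg _) (norm_nonneg _)))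
  rw [L2.inner_def]
  refine integral_congr_ae ?_
  filter_upwards [(Lp.memLp (proj N u)).norm.coeFn_toLp, (Lp.memLp (proj N w)).norm.coeFn_toLp,
    ContinuousMap.coeFn_toLp (𝕜 := ℝ) (p := 2) volume (lowPart N u),
    ContinuousMap.coeFn_toLp (𝕜 := ℝ) (p := 2) volume (lowPart N w)] with x h1 h2 h3 h4
  rw [h1, h2, RCLike.inner_apply, conj_trivial, mul_comm, proj, proj, h3, h4]

/-- Origin of the constant `3`: the average costs one, as `(2π)⁻¹ ≤ 1`, and the derivative of the
square costs two. -/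
theorem integral_lineDensity_le {u w : L2Field} (N : ℝ) {V : ℝ} (hu : ‖u‖ ≤ V) (hw : ‖w‖ ≤ V) :
    ∫ x, lineDensity N u w x ≤ 3 * V * ‖u‖ := by
  have h1 : ∫ x, lineDensity N u w x ≤ ∫ x, (‖lowPart N u x‖ * ‖lowPart N u x‖ +
      2 * (‖lowPart N u x‖ * ‖lowPart N w x‖)) := by
    refine integral_mono
      ((continuous_lineDensity N u w).integrable_of_hasCompactSupport
        (HasCompactSupport.of_compactSpace _))
      (Continuous.integrable_of_hasCompactSupport (by fun_prop)
        (HasCompactSupport.of_compactSpace _)) fun x => ?_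
    unfold lineDensity
    refine add_le_add ?_ ?_
    · rw [← sq]
      refine mul_le_of_le_one_left (sq_nonneg _) (inv_le_one_of_one_le₀ ?_)
      nlinarith [Real.pi_gt_three]
    · rw [abs_mul, abs_two]
      exact mul_le_mul_of_nonneg_left (abs_real_inner_le_norm _ _) zero_le_two
  rw [integral_add (Continuous.integrable_of_hasCompactSupport (by fun_prop)
        (HasCompactSupport.of_compactSpace _)) (Continuous.integrable_of_hasCompactSupport
        (by fun_prop) (HasCompactSupport.of_compactSpace _)), integral_const_mul] at h1
  have h2 := integral_inner_lowPart N u u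
  have h3 := integral_inner_lowPart N u w
  have h4 := mul_le_mul_of_nonneg_left hu (norm_nonneg u)
  have h5 := mul_le_mul_of_nonneg_left hw (norm_nonneg u)
  nlinarith

theorem norm_partialDeriv_le_normV (u : L2Field) (j : Fin 2) : ‖partialDeriv j u‖ ≤ normV u := by
  refine le_of_sq_le_sq ?_ (normV_nonneg u)
  rw [normV_sq]
  exact Finset.single_le_sum (f := fun j => ‖partialDeriv j u‖ ^ 2)
    (fun _ _ => sq_nonneg _) (Finset.mem_univ j)

theorem integral_norm_lowPart_pow_four_le {u : L2Field} (hu : InV u) (N : ℝ) :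
    ∫ x, (‖lowPart N u x‖ ^ 2) ^ 2 ≤ (3 * normV u * ‖u‖) * (3 * normV u * ‖u‖) := by
  have hcont : ∀ w : L2Field, Continuous fun x => 2 * inner ℝ (lowPart N u x) (lowPart N w x) :=
    fun w => by fun_prop
  have hsq : Continuous fun x => ‖lowPart N u x‖ ^ 2 := by fun_prop
  have hI : ∀ {g : AddCircle (2 * Real.pi) → ℝ}, Continuous g → Integrable g volume := fun hg =>
    hg.integrable_of_hasCompactSupport (HasCompactSupport.of_compactSpace _)
  have hline : ∀ (w : L2Field) {γ : AddCircle (2 * Real.pi) → Torus}, Continuous γ →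
      (∀ s : ℝ, HasDerivAt (fun s : ℝ => ‖lowPart N u (γ s)‖ ^ 2)
        (2 * inner ℝ (lowPart N u (γ s)) (lowPart N w (γ s))) s) →
      ∀ a, ‖lowPart N u (γ a)‖ ^ 2 ≤ ∫ c, lineDensity N u w (γ c) := by
    intro w γ hγ hd a
    refine (le_average_add_integral_abs_deriv (hsq.comp hγ) ((hcont w).comp hγ) hd a).trans_eq ?_
    rw [← integral_const_mul]
    exact (integral_add (hI ((hsq.comp hγ).const_mul _)) (hI ((hcont w).comp hγ).abs)).symm
  refine (integral_sq_le_mul hsq (continuous_lineDensity N u (partialDeriv 0 u))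
    (continuous_lineDensity N u (partialDeriv 1 u)) (fun x => sq_nonneg _) ?_ ?_).trans
    (mul_le_mul (integral_lineDensity_le N (norm_le_normV hu) (norm_partialDeriv_le_normV u 0))
      (integral_lineDensity_le N (norm_le_normV hu) (norm_partialDeriv_le_normV u 1))
      (integral_nonneg fun x => by unfold lineDensity; positivity)
      (by have := normV_nonneg u; positivity))
  · intro a b
    refine hline (partialDeriv 0 u) (γ := fun c => ![c, b]) ?_ (fun s => ?_) a
    · refine continuous_pi fun i => ?_
      fin_cases i
      · exact continuous_id
      · exact continuous_const
    · refine hasDerivAt_norm_lowPart_sq (γ := fun s : ℝ => ![(s : AddCircle (2 * Real.pi)), b]) N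
        (hu.isWeakDeriv 0) fun k => ?_
      rw [character, ← mul_assoc]
      exact (hasDerivAt_fourier_two_pi (k 0) s).mul_const (fourier (k 1) b)
  · intro a b
    refine hline (partialDeriv 1 u) (γ := fun c => ![a, c]) ?_ (fun s => ?_) b
    · refine continuous_pi fun i => ?_
      fin_cases i
      · exact continuous_const
      · exact continuous_id
    · refine hasDerivAt_norm_lowPart_sq (γ := fun s : ℝ => ![a, (s : AddCircle (2 * Real.pi))]) N
        (hu.isWeakDeriv 1) fun k => ?_
      rw [character, mul_left_comm]
      exact (hasDerivAt_fourier_two_pi (k 1) s).const_mul (fourier (k 0) a)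

/-- **Ladyzhenskaya's inequality**, with the constant `3`. -/
theorem isLadyzhenskayaConstant_three : IsLadyzhenskayaConstant 3 := by
  refine ⟨by norm_num, fun u hu => ?_⟩
  have hB : 0 ≤ 3 * normV u * ‖u‖ := by have := normV_nonneg u; positivity
  have h1 : ∀ N : ℝ, eLpNorm (lowPart N u) 4 volume ≤ ENNReal.ofReal √(3 * normV u * ‖u‖) := by
    intro N
    have hm : MemLp (lowPart N u) 4 (volume : Measure Torus) :=
      (lowPart N u).continuous.memLp_of_hasCompactSupport (HasCompactSupport.of_compactSpace _)
    rw [hm.eLpNorm_eq_integral_rpow_norm (by norm_num) (by norm_num)]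
    refine ENNReal.ofReal_le_ofReal ?_
    have h4 : (4 : ℝ≥0∞).toReal = 4 := by norm_num
    rw [h4, Real.sqrt_eq_rpow]
    have h5 : ∫ x, ‖lowPart N u x‖ ^ (4 : ℝ) ≤ (3 * normV u * ‖u‖) ^ (2 : ℝ) := by
      rw [Real.rpow_two, sq]
      refine le_trans (le_of_eq ?_) (integral_norm_lowPart_pow_four_le hu N)
      refine integral_congr_ae (.of_forall fun x => ?_)
      simp only
      rw [show (4 : ℝ) = ((4 : ℕ) : ℝ) by norm_num, Real.rpow_natCast, ← pow_mul]
    refine (Real.rpow_le_rpow (integral_nonneg fun x => by positivity) h5 (by norm_num)).trans_eq ?_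
    rw [← Real.rpow_mul hB]
    norm_num
  obtain ⟨ns, -, h⟩ := exists_seq_lowPart_tendsto u
  -- The bound is uniform in the truncation, so Fatou's lemma along an almost everywhere convergent
  -- subsequence carries it to `u`.
  have h2 : eLpNorm u 4 volume ≤ ENNReal.ofReal √(3 * normV u * ‖u‖) := by
    refine (Lp.eLpNorm_lim_le_liminf_eLpNorm (f := fun i x => lowPart (ns i) u x)
      (fun i => (lowPart (ns i) u).continuous.aestronglyMeasurable) _ h).trans ?_
    exact liminf_le_of_le (by isBoundedDefault) fun b hb => by
      obtain ⟨i, hi⟩ := hb.exists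
      exact hi.trans (h1 _)
  calc eLpNorm u 4 volume ^ 2 ≤ ENNReal.ofReal √(3 * normV u * ‖u‖) ^ 2 := by gcongr
    _ = _ := by rw [← ENNReal.ofReal_pow (Real.sqrt_nonneg _), Real.sq_sqrt hB]

/-! ### Energy estimates and synchronization -/

theorem IsStrongSolution.exists_deriv {ν : ℝ} {F v : ℝ → L2Field} (h : IsStrongSolution ν F v) :
    ∃ v' : ℝ → L2Field, (∀ T, 0 ≤ T → IntervalIntegrable v' volume 0 T) ∧
      (∀ t, 0 ≤ t → v t = v 0 + ∫ s in (0 : ℝ)..t, v' s) ∧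
      ∀ᵐ t, 0 < t → ∃ hD : InDA (v t), ∀ φ, InH φ →
        inner ℝ (v' t) φ + ν * inner ℝ (stokes (v t)) φ + inner ℝ (advectionLp hD (v t)) φ =
          (inner ℝ (F t) φ : ℝ) := by
  obtain ⟨v', h1, h2, h3⟩ := h.equation
  refine ⟨v', fun T hT => ?_, h2, ?_⟩
  · rcases hT.eq_or_lt with rfl | hT
    · exact IntervalIntegrable.refl
    · rw [intervalIntegrable_iff, uIoc_of_le hT.le]
      exact (h1 T hT).integrable (by norm_num)
  · have h4 := (ae_restrict_iff' measurableSet_Ioi).1 h.memDA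
    have h5 := (ae_restrict_iff' measurableSet_Ioi).1 h3
    filter_upwards [h4, h5] with t h4 h5 ht
    refine ⟨h4 ht, fun φ hφ => inner_weak_form hφ fun k => ?_⟩
    rw [← coeff_advection]
    exact h5 ht k

theorem IsStrongSolution.intervalIntegrable_stokes {ν : ℝ} {F v : ℝ → L2Field}
    (h : IsStrongSolution ν F v) {T : ℝ} (hT : 0 ≤ T) :
    IntervalIntegrable (fun t => stokes (v t)) volume 0 T := by
  rcases hT.eq_or_lt with rfl | hT
  · exact IntervalIntegrable.refl
  · rw [intervalIntegrable_iff, uIoc_of_le hT.le]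
    exact (h.stokesL2 T hT).integrable (by norm_num)

theorem IsForce.ae_norm_le {g : ℝ → L2Field} (hg : IsForce g) {ν : ℝ} (hν : 0 < ν) :
    ∀ᵐ t, 0 < t → ‖g t‖ ≤ grashof ν g * ν ^ 2 := by
  have h1 := ae_le_eLpNormEssSup (f := g) (μ := volume.restrict (Ioi (0 : ℝ)))
  rw [← eLpNorm_exponent_top] at h1
  filter_upwards [(ae_restrict_iff' measurableSet_Ioi).1 h1] with t ht h0
  rw [grashof, div_mul_cancel₀ _ (by positivity), ← toReal_enorm]
  exact ENNReal.toReal_mono hg.1.2.ne (ht h0)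

theorem two_mul_le_add_div {a b ν : ℝ} (hν : 0 < ν) : 2 * a * b ≤ ν * b ^ 2 + a ^ 2 / ν := by
  have h : 0 ≤ (ν * b - a) ^ 2 / ν := by positivity
  have h2 : (ν * b - a) ^ 2 / ν = ν * b ^ 2 + a ^ 2 / ν - 2 * a * b := by
    field_simp
    ring
  linarith

theorem SelfSynchronousAssistedBy.symm {N ν μ₁ μ₂ M : ℝ} {g₁ g₂ : ℝ → L2Field}
    (h : SelfSynchronousAssistedBy N ν μ₂ μ₁ M g₂ g₁) :
    SelfSynchronousAssistedBy N ν μ₁ μ₂ M g₁ g₂ := by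
  intro hg v₁ v₂ hv hP
  have e : ∀ a b : ℝ → L2Field, (fun t => ‖a t - b t‖) = fun t => ‖b t - a t‖ :=
    fun a b => funext fun t => norm_sub_rev (a t) (b t)
  rw [e] at hg ⊢
  rw [e (fun t => proj N (v₁ t)) (fun t => proj N (v₂ t))] at hP
  exact h hg v₂ v₁ ⟨hv.2, hv.1⟩ hP

theorem two_inner_le {g v : L2Field} {ν G : ℝ} (hν : 0 < ν) (hv : InV v) (hg : ‖g‖ ≤ G * ν ^ 2) :
    2 * inner ℝ g v ≤ ν * normV v ^ 2 + ν ^ 3 * G ^ 2 := by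
  have h7 := real_inner_le_norm g v
  have h8 : ‖g‖ * ‖v‖ ≤ (G * ν ^ 2) * normV v :=
    mul_le_mul hg (norm_le_normV hv) (norm_nonneg _) ((norm_nonneg g).trans hg)
  have h9 := two_mul_le_add_div (a := G * ν ^ 2) (b := normV v) hν
  have h10 : (G * ν ^ 2) ^ 2 / ν = ν ^ 3 * G ^ 2 := by field_simp
  linarith

/-- The weight satisfies `θμ₂ = μ₁`, so that both nudging terms carry the factor `μ₁` and add up to
`-2μ₁|P_M(v₁ - v₂)|² ≤ 0`. Half of the dissipation absorbs the forces. -/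
theorem energy_rate_le {ν μ₁ μ₂ θ M G₁ G₂ : ℝ} {v₁ v₂ a₁ a₂ g₁ g₂ : L2Field} (hν : 0 < ν)
    (hμ₁ : 0 ≤ μ₁) (hθ0 : 0 ≤ θ) (hθ1 : θ ≤ 1) (hθ : θ * μ₂ = μ₁)
    (hV₁ : InV v₁) (hV₂ : InV v₂) (hD₁ : InDA v₁) (hD₂ : InDA v₂)
    (hg₁ : ‖g₁‖ ≤ G₁ * ν ^ 2) (hg₂ : ‖g₂‖ ≤ G₂ * ν ^ 2)
    (h1 : inner ℝ a₁ v₁ + ν * inner ℝ (stokes v₁) v₁ + inner ℝ (advectionLp hD₁ v₁) v₁ =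
      (inner ℝ (g₁ + μ₁ • (proj M v₂ - proj M v₁)) v₁ : ℝ))
    (h2 : inner ℝ a₂ v₂ + ν * inner ℝ (stokes v₂) v₂ + inner ℝ (advectionLp hD₂ v₂) v₂ =
      (inner ℝ (g₂ + μ₂ • (proj M v₁ - proj M v₂)) v₂ : ℝ)) :
    2 * inner ℝ a₁ v₁ + θ * (2 * inner ℝ a₂ v₂) ≤
      ν ^ 3 * (G₁ ^ 2 + G₂ ^ 2) - ν * normV v₁ ^ 2 - ν * (θ * normV v₂ ^ 2) := by
  rw [inner_advectionLp_self hD₁ hV₁, inner_stokes hV₁ hD₁, inner_add_left,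
    real_inner_smul_left] at h1
  rw [inner_advectionLp_self hD₂ hV₂, inner_stokes hV₂ hD₂, inner_add_left,
    real_inner_smul_left] at h2
  have h5 : inner ℝ (proj M v₂ - proj M v₁) v₁ + inner ℝ (proj M v₁ - proj M v₂) v₂ ≤ (0 : ℝ) := by
    have h6 : (0 : ℝ) ≤ inner ℝ (proj M (v₁ - v₂)) (v₁ - v₂) := by
      rw [inner_proj_left, real_inner_self_eq_norm_sq]
      positivity
    rw [proj_sub, inner_sub_right] at h6
    rw [← neg_sub (proj M v₁), inner_neg_left]
    linarith
  have k1 := two_inner_le hν hV₁ hg₁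
  have k2 := mul_le_mul_of_nonneg_left (two_inner_le hν hV₂ hg₂) hθ0
  have k3 := mul_le_mul_of_nonneg_left h5 hμ₁
  have k4 : θ * (ν ^ 3 * G₂ ^ 2) ≤ ν ^ 3 * G₂ ^ 2 := mul_le_of_le_one_left (by positivity) hθ1
  have k5 : θ * (μ₂ * inner ℝ (proj M v₁ - proj M v₂) v₂) =
      μ₁ * inner ℝ (proj M v₁ - proj M v₂) v₂ := by rw [← mul_assoc, hθ]
  rw [add_zero, ← eq_sub_iff_add_eq] at h1 h2
  rw [h1, h2]
  linarith

/-- The weighted energy is bounded, and controls the time averages of the enstrophy of the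
solution with the smaller nudging parameter. -/
theorem exists_integral_enstrophy_le {ν μ₁ μ₂ M : ℝ} {g₁ g₂ v₁ v₂ : ℝ → L2Field} (hν : 0 < ν)
    (hg₁ : IsForce g₁) (hg₂ : IsForce g₂) (hμ₁ : 0 ≤ μ₁) (hμ : μ₁ ≤ μ₂)
    (hv : IsMutualNudging ν μ₁ μ₂ M g₁ g₂ v₁ v₂) :
    ∃ B, ∀ r t, 0 ≤ r → r ≤ t → ∫ s in r..t, inner ℝ (stokes (v₁ s)) (v₁ s) ≤
      B + ν ^ 2 * (grashof ν g₁ ^ 2 + grashof ν g₂ ^ 2) * (t - r) := by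
  obtain ⟨v₁', hi₁, he₁, hw₁⟩ := hv.1.exists_deriv
  obtain ⟨v₂', hi₂, he₂, hw₂⟩ := hv.2.exists_deriv
  obtain ⟨θ, hθ0, hθ1, hθ⟩ : ∃ θ : ℝ, 0 ≤ θ ∧ θ ≤ 1 ∧ θ * μ₂ = μ₁ := by
    rcases (hμ₁.trans hμ).eq_or_lt with h | h
    -- If `μ₂ = 0` then `μ₁ = 0` as well, and `v₁` evolves on its own.
    · exact ⟨0, le_rfl, zero_le_one, by rw [zero_mul]; linarith⟩
    · exact ⟨μ₁ / μ₂, by positivity, (div_le_one h).2 hμ, div_mul_cancel₀ _ h.ne'⟩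
  have hc₁ : ∀ t, 0 ≤ t → ContinuousOn v₁ (uIcc 0 t) := fun t ht =>
    continuousOn_of_eq_integral ht (hi₁ t ht) fun s hs => he₁ s hs.1
  have hc₂ : ∀ t, 0 ≤ t → ContinuousOn v₂ (uIcc 0 t) := fun t ht =>
    continuousOn_of_eq_integral ht (hi₂ t ht) fun s hs => he₂ s hs.1
  set e : ℝ → ℝ := fun t => ‖v₁ t‖ ^ 2 + θ * ‖v₂ t‖ ^ 2 with he
  set h : ℝ → ℝ := fun t => 2 * inner ℝ (v₁' t) (v₁ t) + θ * (2 * inner ℝ (v₂' t) (v₂ t)) with hh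
  -- This equals `‖v₁‖²` almost everywhere; in this form it is integrable because `A v₁` is
  -- integrable and `v₁` continuous in time.
  set d : ℝ → ℝ := fun t => inner ℝ (stokes (v₁ t)) (v₁ t) with hd
  set c₀ := ν ^ 3 * (grashof ν g₁ ^ 2 + grashof ν g₂ ^ 2) with hc₀
  have hi₁' : ∀ t, 0 ≤ t → IntervalIntegrable (fun s => 2 * inner ℝ (v₁' s) (v₁ s)) volume 0 t :=
    fun t ht => (intervalIntegrable_inner_continuousOn (hi₁ t ht) (hc₁ t ht)).const_mul 2
  have hi₂' : ∀ t, 0 ≤ t →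
      IntervalIntegrable (fun s => θ * (2 * inner ℝ (v₂' s) (v₂ s))) volume 0 t :=
    fun t ht => ((intervalIntegrable_inner_continuousOn (hi₂ t ht) (hc₂ t ht)).const_mul 2).const_mul θ
  have hih : ∀ t, 0 ≤ t → IntervalIntegrable h volume 0 t := fun t ht => (hi₁' t ht).add (hi₂' t ht)
  have hid : ∀ t, 0 ≤ t → IntervalIntegrable d volume 0 t := fun t ht =>
    intervalIntegrable_inner_continuousOn (hv.1.intervalIntegrable_stokes ht) (hc₁ t ht)
  have hee : ∀ t, 0 ≤ t → e t = e 0 + ∫ s in (0 : ℝ)..t, h s := by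
    intro t ht
    simp only [he, hh]
    rw [intervalIntegral.integral_add (hi₁' t ht) (hi₂' t ht), intervalIntegral.integral_const_mul θ,
      norm_sq_eq_integral ht (hi₁ t ht) fun s hs => he₁ s hs.1,
      norm_sq_eq_integral ht (hi₂ t ht) fun s hs => he₂ s hs.1]
    ring
  have hle : ∀ᵐ t, 0 < t → h t ≤ c₀ - ν * d t ∧ h t ≤ c₀ - ν * e t := by
    filter_upwards [hw₁, hw₂, hg₁.ae_norm_le hν, hg₂.ae_norm_le hν] with t h1 h2 h3 h4 ht
    obtain ⟨hD₁, h1⟩ := h1 ht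
    obtain ⟨hD₂, h2⟩ := h2 ht
    have hV₁ := hv.1.memV t ht.le
    have hV₂ := hv.2.memV t ht.le
    have h8 : h t ≤ c₀ - ν * normV (v₁ t) ^ 2 - ν * (θ * normV (v₂ t) ^ 2) :=
      energy_rate_le hν hμ₁ hθ0 hθ1 hθ hV₁ hV₂ hD₁ hD₂ (h3 ht) (h4 ht) (h1 _ hD₁.1) (h2 _ hD₂.1)
    constructor
    · simp only [hd]
      rw [inner_stokes hV₁ hD₁]
      have : 0 ≤ ν * (θ * normV (v₂ t) ^ 2) := by positivity
      linarith
    · have p1 : ‖v₁ t‖ ^ 2 ≤ normV (v₁ t) ^ 2 := pow_le_pow_left₀ (norm_nonneg _) (norm_le_normV hV₁) 2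
      have p2 : ‖v₂ t‖ ^ 2 ≤ normV (v₂ t) ^ 2 := pow_le_pow_left₀ (norm_nonneg _) (norm_le_normV hV₂) 2
      have p3 : e t ≤ normV (v₁ t) ^ 2 + θ * normV (v₂ t) ^ 2 :=
        add_le_add p1 (mul_le_mul_of_nonneg_left p2 hθ0)
      have := mul_le_mul_of_nonneg_left p3 hν.le
      linarith
  have he0 : ∀ t, 0 ≤ e t := fun t => by simp only [he]; positivity
  have hc₀' : 0 ≤ c₀ := by positivity
  -- By Poincaré's inequality the energy satisfies `e' ≤ c₀ - νe`. The uniform bound makes the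
  -- constant `B` independent of the starting time.
  have hbound : ∀ t, 0 ≤ t → e t ≤ e 0 + c₀ / ν := by
    intro t ht
    have := gronwall_average (y := e) (h := h) (c := fun _ => 0) (s := 0) (t := t) (κ := ν) (κ' := 0)
      (K := 0) (ε := c₀) ht (hih t ht) intervalIntegrable_const (fun r hr => hee r hr.1) (he0 0)
      hc₀' (by
        filter_upwards [hle] with r hr hrt
        linarith [(hr hrt.1).2]) (by simp) hν
    rw [Real.exp_zero, one_mul, sub_zero, sub_zero] at this
    refine this.trans (add_le_add_left ?_ _)
    refine mul_le_of_le_one_left (he0 0) (Real.exp_le_one_iff.2 ?_)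
    nlinarith
  refine ⟨(e 0 + c₀ / ν) / ν, fun r t hr hrt => ?_⟩
  have ht := hr.trans hrt
  have hih' : IntervalIntegrable h volume r t := (hih r hr).symm.trans (hih t ht)
  have hid' : IntervalIntegrable d volume r t := (hid r hr).symm.trans (hid t ht)
  have h1 : ∫ s in r..t, h s = e t - e r := by
    rw [hee t ht, hee r hr, add_sub_add_left_eq_sub,
      intervalIntegral.integral_interval_sub_left (hih t ht) (hih r hr)]
  have h2 : ∫ s in r..t, h s ≤ ∫ s in r..t, (c₀ - ν * d s) := by
    refine intervalIntegral.integral_mono_ae_restrict hrt hih'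
      (intervalIntegrable_const.sub (hid'.const_mul ν)) ?_
    refine (ae_restrict_iff' measurableSet_Icc).2 ?_
    have h0 : ∀ᵐ x : ℝ, x ≠ 0 := by simp [ae_iff, measure_singleton]
    filter_upwards [hle, h0] with s hs hs0 hsI
    exact (hs (lt_of_le_of_ne (hr.trans hsI.1) (Ne.symm hs0))).1
  rw [intervalIntegral.integral_sub intervalIntegrable_const (hid'.const_mul ν),
    intervalIntegral.integral_const, intervalIntegral.integral_const_mul, smul_eq_mul, h1] at h2
  have h3 := hbound r hr
  have h4 := he0 t
  have h5 : ν * ∫ s in r..t, d s ≤ (e 0 + c₀ / ν) + c₀ * (t - r) := by linarith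
  have h6 : ν * ((e 0 + c₀ / ν) / ν + ν ^ 2 * (grashof ν g₁ ^ 2 + grashof ν g₂ ^ 2) * (t - r)) =
      (e 0 + c₀ / ν) + c₀ * (t - r) := by
    rw [mul_add, mul_div_cancel₀ _ hν.ne', hc₀]
    ring
  rw [← h6] at h5
  exact le_of_mul_le_mul_left h5 hν

/-! ### The difference of the two solutions -/

/-- Of the dissipation `2ν‖w‖²`, one half absorbs the trilinear term and the other gives the damping
through the Poincaré inequality for high modes. The small loss `η` pays for the forces. -/
theorem difference_rate_le {ν μ₁ μ₂ M N C η : ℝ} {v₁ v₂ a₁ a₂ g₁ g₂ : L2Field} (hν : 0 < ν)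
    (hη : 0 < η) (hμ : 0 ≤ μ₁ + μ₂) (hN : 0 ≤ N) (hC : IsLadyzhenskayaConstant C)
    (hV₁ : InV v₁) (hV₂ : InV v₂) (hD₁ : InDA v₁) (hD₂ : InDA v₂)
    (h1 : ∀ φ, InH φ →
      inner ℝ a₁ φ + ν * inner ℝ (stokes v₁) φ + inner ℝ (advectionLp hD₁ v₁) φ =
        (inner ℝ (g₁ + μ₁ • (proj M v₂ - proj M v₁)) φ : ℝ))
    (h2 : ∀ φ, InH φ →
      inner ℝ a₂ φ + ν * inner ℝ (stokes v₂) φ + inner ℝ (advectionLp hD₂ v₂) φ =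
        (inner ℝ (g₂ + μ₂ • (proj M v₁ - proj M v₂)) φ : ℝ)) :
    2 * inner ℝ (a₁ - a₂) (v₁ - v₂) ≤
      (C ^ 2 / ν * inner ℝ (stokes v₁) v₁ - (ν * max N 1 ^ 2 - η)) * ‖v₁ - v₂‖ ^ 2 +
        (ν * max N 1 ^ 2 * ‖proj N v₁ - proj N v₂‖ ^ 2 + ‖g₁ - g₂‖ ^ 2 / η) := by
  set w := v₁ - v₂ with hw
  have hVw : InV w := hV₁.sub hV₂
  have hDw : InDA w := hD₁.sub hD₂
  have e1 := h1 w hVw.1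
  have e2 := h2 w hVw.1
  have hadv : inner ℝ (advectionLp hD₁ v₁) w - inner ℝ (advectionLp hD₂ v₂) w =
      (inner ℝ (advectionLp hDw v₁) w : ℝ) := by
    rw [← inner_sub_left, advectionLp_sub hD₁ hD₂ hV₁ hV₂, inner_add_left,
      inner_advectionLp_self hD₂ hVw, add_zero]
  have hst : inner ℝ (stokes v₁) w - inner ℝ (stokes v₂) w = normV w ^ 2 := by
    rw [← inner_sub_left, ← stokes_sub hD₁ hD₂, inner_stokes hVw hDw]
  have hp : (0 : ℝ) ≤ inner ℝ (proj M v₁ - proj M v₂) w := by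
    rw [← proj_sub, ← hw, inner_proj_left, real_inner_self_eq_norm_sq]
    positivity
  rw [inner_add_left, real_inner_smul_left] at e1 e2
  rw [← neg_sub (proj M v₁), inner_neg_left] at e1
  have hg : inner ℝ g₁ w - inner ℝ g₂ w = (inner ℝ (g₁ - g₂) w : ℝ) := (inner_sub_left _ _ _).symm
  have e3 : inner ℝ (a₁ - a₂) w = inner ℝ (g₁ - g₂) w - (μ₁ + μ₂) * inner ℝ (proj M v₁ - proj M v₂) w -
      ν * normV w ^ 2 - inner ℝ (advectionLp hDw v₁) w := by
    rw [inner_sub_left, ← hadv, ← hst, ← hg]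
    linarith
  have b1 : 2 * inner ℝ (g₁ - g₂) w ≤ η * ‖w‖ ^ 2 + ‖g₁ - g₂‖ ^ 2 / η := by
    have := real_inner_le_norm (g₁ - g₂) w
    have := two_mul_le_add_div (a := ‖g₁ - g₂‖) (b := ‖w‖) hη
    linarith
  have b2 : -(2 * inner ℝ (advectionLp hDw v₁) w) ≤
      ν * normV w ^ 2 + C ^ 2 / ν * normV v₁ ^ 2 * ‖w‖ ^ 2 := by
    have h3 := abs_inner_advectionLp_le (v := v₁) hC hDw hVw
    have h4 := (abs_le.1 h3).1
    have h5 := two_mul_le_add_div (a := C * normV v₁ * ‖w‖) (b := normV w) hν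
    have h6 : (C * normV v₁ * ‖w‖) ^ 2 / ν = C ^ 2 / ν * normV v₁ ^ 2 * ‖w‖ ^ 2 := by ring
    linarith
  have b3 := mul_le_mul_of_nonneg_left (poincare_high hVw hN) hν.le
  have b4 : 0 ≤ (μ₁ + μ₂) * inner ℝ (proj M v₁ - proj M v₂) w := mul_nonneg hμ hp
  rw [show proj N w = proj N v₁ - proj N v₂ from proj_sub N v₁ v₂] at b3
  rw [inner_stokes hV₁ hD₁, e3]
  linarith

/-- Synchronization, when the Grashof numbers are small compared with the assisting modes. -/
theorem selfSynchronousAssistedBy_of_le {ν μ₁ μ₂ M N C : ℝ} {g₁ g₂ : ℝ → L2Field} (hν : 0 < ν)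
    (hg₁ : IsForce g₁) (hg₂ : IsForce g₂) (hμ₁ : 0 ≤ μ₁) (hμ : μ₁ ≤ μ₂) (hN : 0 ≤ N)
    (hC : IsLadyzhenskayaConstant C)
    (hlt : C ^ 2 * (grashof ν g₁ ^ 2 + grashof ν g₂ ^ 2) < max N 1 ^ 2) :
    SelfSynchronousAssistedBy N ν μ₁ μ₂ M g₁ g₂ := by
  intro hg v₁ v₂ hv hP
  obtain ⟨B, hB⟩ := exists_integral_enstrophy_le hν hg₁ hg₂ hμ₁ hμ hv
  obtain ⟨v₁', hi₁, he₁, hw₁⟩ := hv.1.exists_deriv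
  obtain ⟨v₂', hi₂, he₂, hw₂⟩ := hv.2.exists_deriv
  set G := grashof ν g₁ ^ 2 + grashof ν g₂ ^ 2 with hG
  -- Half of the gap between damping and average growth: the other half, again `η`, remains as the
  -- net decay rate.
  set η := ν * (max N 1 ^ 2 - C ^ 2 * G) / 2 with hη
  have hη0 : 0 < η := by
    have := sub_pos.2 hlt
    positivity
  set c : ℝ → ℝ := fun t => C ^ 2 / ν * inner ℝ (stokes (v₁ t)) (v₁ t) with hc
  set h : ℝ → ℝ := fun t => 2 * inner ℝ (v₁' t - v₂' t) (v₁ t - v₂ t) with hh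
  set y : ℝ → ℝ := fun t => ‖v₁ t - v₂ t‖ ^ 2 with hy
  set b : ℝ → ℝ := fun t => ν * max N 1 ^ 2 * ‖proj N (v₁ t) - proj N (v₂ t)‖ ^ 2 +
    ‖g₁ t - g₂ t‖ ^ 2 / η with hb
  have hcont : ∀ t, 0 ≤ t → ContinuousOn v₁ (uIcc 0 t) := fun t ht =>
    continuousOn_of_eq_integral ht (hi₁ t ht) fun s hs => he₁ s hs.1
  have hic : ∀ t, 0 ≤ t → IntervalIntegrable c volume 0 t := fun t ht =>
    (intervalIntegrable_inner_continuousOn (hv.1.intervalIntegrable_stokes ht)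
      (hcont t ht)).const_mul _
  have hiw : ∀ t, 0 ≤ t → IntervalIntegrable (fun s => v₁' s - v₂' s) volume 0 t :=
    fun t ht => (hi₁ t ht).sub (hi₂ t ht)
  have hew : ∀ t, 0 ≤ t → v₁ t - v₂ t = (v₁ 0 - v₂ 0) + ∫ s in (0 : ℝ)..t, (v₁' s - v₂' s) := by
    intro t ht
    rw [intervalIntegral.integral_sub (hi₁ t ht) (hi₂ t ht), he₁ t ht, he₂ t ht]
    abel
  have hih : ∀ t, 0 ≤ t → IntervalIntegrable h volume 0 t := fun t ht =>
    (intervalIntegrable_inner_continuousOn (hiw t ht) (continuousOn_of_eq_integral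
      (v := fun t => v₁ t - v₂ t) ht (hiw t ht) fun s hs => hew s hs.1)).const_mul 2
  have hey : ∀ t, 0 ≤ t → y t = y 0 + ∫ s in (0 : ℝ)..t, h s := fun t ht =>
    norm_sq_eq_integral (v := fun t => v₁ t - v₂ t) ht (hiw t ht) fun s hs => hew s hs.1
  have hrate : ∀ᵐ t, 0 < t → h t ≤ (c t - (ν * max N 1 ^ 2 - η)) * y t + b t := by
    filter_upwards [hw₁, hw₂] with t h1 h2 ht
    obtain ⟨hD₁, h1⟩ := h1 ht
    obtain ⟨hD₂, h2⟩ := h2 ht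
    exact difference_rate_le hν hη0 (by linarith) hN hC (hv.1.memV t ht.le) (hv.2.memV t ht.le)
      hD₁ hD₂ h1 h2
  have hbt : Tendsto b (atTop ⊓ ae volume) (𝓝 0) := by
    have := (((hP.mono_left inf_le_left).pow 2).const_mul (ν * max N 1 ^ 2)).add
      ((hg.pow 2).div_const η)
    simpa using this
  have hcK : ∀ r t, 0 ≤ r → r ≤ t →
      ∫ x in r..t, c x ≤ C ^ 2 / ν * B + ν * C ^ 2 * G * (t - r) := by
    intro r t hr hrt
    simp only [hc]
    rw [intervalIntegral.integral_const_mul]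
    have h1 := mul_le_mul_of_nonneg_left (hB r t hr hrt) (show 0 ≤ C ^ 2 / ν by positivity)
    refine h1.trans_eq ?_
    field_simp
  have hκ : ν * max N 1 ^ 2 - η - ν * C ^ 2 * G = η := by rw [hη]; ring
  have hy0 : Tendsto y atTop (𝓝 0) := by
    rw [Metric.tendsto_nhds]
    intro ε₀ hε₀
    set K := C ^ 2 / ν * B
    -- With this choice the limit of the Gronwall bound is `ε₀ / 2`.
    set ε := ε₀ / 2 * η / Real.exp K with hε
    have hε0 : 0 < ε := by positivity
    have h1 : ∀ᶠ t in atTop ⊓ ae volume, b t ≤ ε := hbt.eventually_le_const hε0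
    obtain ⟨S, hS, S', hS', hSS⟩ := eventually_inf.1 h1
    obtain ⟨s₀, hs₀⟩ := mem_atTop_sets.1 hS
    set s := max s₀ 0
    have hs : 0 ≤ s := le_max_right _ _
    have h2 : ∀ t, s ≤ t → y t ≤ Real.exp K * (Real.exp (-η * (t - s)) * y s + ε / η) := by
      intro t hst
      have ht := hs.trans hst
      have h3 := gronwall_average (y := y) (h := h) (c := c) (s := s) (t := t)
        (κ := ν * max N 1 ^ 2 - η) (κ' := ν * C ^ 2 * G) (K := K) (ε := ε) hst
        ((hih s hs).symm.trans (hih t ht)) ((hic s hs).symm.trans (hic t ht)) (fun r hr => by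
          have hr0 := hs.trans hr.1
          rw [hey r hr0, hey s hs, add_assoc,
            intervalIntegral.integral_add_adjacent_intervals (hih s hs)
              ((hih s hs).symm.trans (hih r hr0))]) (sq_nonneg _) hε0.le (by
          filter_upwards [hrate, hS'] with r hr hrS hrI
          have hr0 := hs.trans_lt hrI.1
          exact (hr hr0).trans (add_le_add_right
            (hSS r ⟨hs₀ r ((le_max_left _ _).trans hrI.1.le), hrS⟩) _))
        (fun r hr => hcK r t (hs.trans hr.1) hr.2) (by linarith)
      rwa [hκ] at h3
    have h4 : Tendsto (fun t => Real.exp K * (Real.exp (-η * (t - s)) * y s + ε / η)) atTop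
        (𝓝 (Real.exp K * (0 * y s + ε / η))) := by
      refine ((Tendsto.mul_const _ ?_).add_const _).const_mul _
      refine Real.tendsto_exp_atBot.comp ?_
      refine Tendsto.const_mul_atTop_of_neg (neg_lt_zero.2 hη0) ?_
      exact tendsto_atTop_add_const_right _ _ tendsto_id
    have h5 : Real.exp K * (0 * y s + ε / η) < ε₀ := by
      rw [hε]
      field_simp
      linarith
    filter_upwards [h4.eventually_lt_const h5, eventually_ge_atTop s] with t ht hst
    rw [Real.dist_eq, sub_zero, abs_of_nonneg (sq_nonneg _)]
    exact (h2 t hst).trans_lt ht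
  have h6 := (Real.continuous_sqrt.tendsto 0).comp hy0
  simpa [Function.comp_def, hy, Real.sqrt_sq (norm_nonneg _)] using h6

theorem selfSynchronousAssistedBy_of_lt {ν μ₁ μ₂ M N C : ℝ} {g₁ g₂ : ℝ → L2Field} (hν : 0 < ν)
    (hg₁ : IsForce g₁) (hg₂ : IsForce g₂) (hμ₁ : 0 ≤ μ₁) (hμ₂ : 0 ≤ μ₂) (hN : 0 ≤ N)
    (hC : IsLadyzhenskayaConstant C)
    (hlt : C ^ 2 * (grashof ν g₁ ^ 2 + grashof ν g₂ ^ 2) < max N 1 ^ 2) :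
    SelfSynchronousAssistedBy N ν μ₁ μ₂ M g₁ g₂ := by
  rcases le_total μ₁ μ₂ with h | h
  · exact selfSynchronousAssistedBy_of_le hν hg₁ hg₂ hμ₁ h hN hC hlt
  · exact (selfSynchronousAssistedBy_of_le hν hg₂ hg₁ hμ₂ h hN hC
      (by rwa [add_comm (grashof ν g₂ ^ 2)])).symm

/-- The smaller of two Ladyzhenskaya constants absorbs the case of small Grashof numbers. -/
theorem sq_mul_lt_max_sq {C C' r G N : ℝ} (hC0 : 0 < C) (hC : C ≤ C') (hC3 : C ≤ 3) (hr : 1 ≤ r)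
    (hG : 0 ≤ G) (hN : 4 * √2 * C' * r * G ≤ N) : C ^ 2 * G < max N 1 ^ 2 := by
  rcases lt_or_ge (C ^ 2 * G) 1 with h | h
  · have := le_max_right N 1
    nlinarith
  · have h2 : 1 ≤ √2 := Real.one_le_sqrt.2 (by norm_num)
    have hG0 : 0 < G := by
      rcases hG.eq_or_lt with h0 | h0
      · rw [← h0] at h; linarith
      · exact h0
    have h3 : 4 * C * G ≤ 4 * √2 * C' * r * G := by
      refine mul_le_mul_of_nonneg_right ?_ hG
      have h4 : 1 * C ≤ √2 * C' := mul_le_mul h2 hC hC0.le (by positivity)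
      have h5 : √2 * C' * 1 ≤ √2 * C' * r :=
        mul_le_mul_of_nonneg_left hr (mul_nonneg (by positivity) (hC0.le.trans hC))
      linarith
    have h6 : 4 * C * G ≤ max N 1 := (h3.trans hN).trans (le_max_left _ _)
    have h7 : (4 * C * G) ^ 2 ≤ max N 1 ^ 2 := pow_le_pow_left₀ (by positivity) h6 2
    -- From `C ≤ 3` and `C²G ≥ 1`. Then `(4CG)² = 16G · C²G ≥ (16/9) C²G`, which exceeds `C²G`.
    have h8 : 1 / 9 ≤ G := by
      have : C ^ 2 ≤ 9 := by nlinarith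
      nlinarith
    have h9 : 0 < C ^ 2 * G := by positivity
    nlinarith

theorem one_le_max_div_min {a b : ℝ} (ha : 0 < a) (hb : 0 < b) : 1 ≤ √(max a b / min a b) := by
  rw [Real.one_le_sqrt, one_le_div (lt_min ha hb)]
  exact min_le_max

end NudgedNSE

end

/-! ### Choice of `N` and conclusion -/

theorem mainTheorem5 :
    (∃ C_L : ℝ, NudgedNSE.IsLadyzhenskayaConstant C_L) ∧
    ∀ (ν : ℝ), 0 < ν → ∀ (g₁ g₂ : ℝ → NudgedNSE.L2Field),
      NudgedNSE.IsForce g₁ → NudgedNSE.IsForce g₂ →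
      (∀ (μ₁ μ₂ : ℝ), 0 ≤ μ₁ → 0 ≤ μ₂ →
        ∃ N : ℝ, 0 < N ∧ ∀ M : ℝ, 0 < M →
          NudgedNSE.SelfSynchronousAssistedBy N ν μ₁ μ₂ M g₁ g₂) ∧
      (∀ (C_L : ℝ), NudgedNSE.IsLadyzhenskayaConstant C_L →
        ∀ (μ₁ μ₂ : ℝ), 0 < μ₁ → 0 < μ₂ →
        ∀ (M N : ℝ), 0 < M → 0 < N →
          4 * √2 * C_L * √(max μ₁ μ₂ / min μ₁ μ₂) *
              (NudgedNSE.grashof ν g₁ ^ 2 + NudgedNSE.grashof ν g₂ ^ 2) ≤ N →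
          NudgedNSE.SelfSynchronousAssistedBy N ν μ₁ μ₂ M g₁ g₂) := by
  refine ⟨⟨3, NudgedNSE.isLadyzhenskayaConstant_three⟩, fun ν hν g₁ g₂ hg₁ hg₂ => ⟨?_, ?_⟩⟩
  · intro μ₁ μ₂ hμ₁ hμ₂
    set G := NudgedNSE.grashof ν g₁ ^ 2 + NudgedNSE.grashof ν g₂ ^ 2 with hG
    have hG0 : 0 ≤ G := by positivity
    -- With `C = 3` the condition reads `9G < N²`, and `9G < (9G + 1)²`. The choice depends neither
    -- on `M` nor on `μ₁, μ₂`.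
    refine ⟨9 * G + 1, by positivity, fun M _ => ?_⟩
    refine NudgedNSE.selfSynchronousAssistedBy_of_lt hν hg₁ hg₂ hμ₁ hμ₂ (by positivity)
      NudgedNSE.isLadyzhenskayaConstant_three ?_
    rw [← hG, max_eq_left (by linarith)]
    nlinarith
  · intro C hC μ₁ μ₂ hμ₁ hμ₂ M N _ hN hle
    have hG0 : 0 ≤ NudgedNSE.grashof ν g₁ ^ 2 + NudgedNSE.grashof ν g₂ ^ 2 := by positivity
    have hr := NudgedNSE.one_le_max_div_min hμ₁ hμ₂
    -- The criterion is applied with the smaller of `C` and `3`; a larger `C` only strengthens the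
    -- hypothesis on `N`.
    rcases le_total C 3 with h | h
    · exact NudgedNSE.selfSynchronousAssistedBy_of_lt hν hg₁ hg₂ hμ₁.le hμ₂.le hN.le hC
        (NudgedNSE.sq_mul_lt_max_sq hC.1 le_rfl h hr hG0 hle)
    · exact NudgedNSE.selfSynchronousAssistedBy_of_lt hν hg₁ hg₂ hμ₁.le hμ₂.le hN.le
        NudgedNSE.isLadyzhenskayaConstant_three
        (NudgedNSE.sq_mul_lt_max_sq (by norm_num) h le_rfl hr hG0 hle)
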